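/- **Conventions.** A category $\mathcal C$ has the *amalgamation property* (AP) if every diagram of shape $\bullet\leftarrow\bullet\to\bullet$ in $\mathcal C$ has a cocone, and the *joint embedding property* (JEP) if every diagram of finite discrete shape (the empty shape included) in $\mathcal C$ has a cocone. An *inverse category* is a category in which every morphism $f:X\to Y$ has a unique pseudoinverse $f^{-1}:Y\to X$, i.e. a morphism with $ff^{-1}f=f$ and $f^{-1}ff^{-1}=f^{-1}$. For a category $\mathcal I$, let $\eta:\mathcal I\to\mathcal L(\mathcal I)$ be the inverse category freely generated by $\mathcal I$ subject to $\eta(i)^{-1}\circ\eta(i)=1$ for every morphism $i$ of $\mathcal I$; $\mathcal I$ is *upward-simply-connected* if every endomorphism $f$ in $\mathcal L(\mathcal I)$ satisfies $f\circ f=f$. The *monic reflection* $\mathcal M(\mathcal I)$ is $\mathcal I/{\sim}$ for the least congruence $\sim$ on $\mathcal I$ such that every morphism of $\mathcal I/{\sim}$ is monic. The finite *tree-like* posets are defined inductively, up to isomorphism: if $K_1,\dots,K_n$ ($n\ge 0$) are finite tree-like posets and $U_k\subseteq K_k$ is a connected (in particular nonempty) upward-closed subset for each $k$, then the disjoint union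 of the $K_k$ together with one new point lying below exactly the elements of $U_1\cup\dots\cup U_n$ and itself is tree-like. A finite *forest-like* poset is a disjoint union of finitely many tree-like posets. A finite category is given explicitly by its number of objects, the list of its morphisms with their sources and targets, and a composition table. **Corollary 6.1 (decidability).** There are algorithms that, given any finite category $\mathcal I$ explicitly, decide 1. whether $\mathcal I$ is upward-simply-connected; the same algorithm decides whether every $\mathcal I$-shaped diagram in a category with the AP and the JEP has a cocone; 2. whether every $\mathcal I$-shaped diagram in a category with the AP has a cocone. Moreover, a finite category $\mathcal I$ is upward-simply-connected if and only if $\mathcal M(\mathcal I)$ is a preorder and the poset equivalent to $\mathcal M(\mathcal I)$ is forest-like. -/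

import Mathlib

open CategoryTheory CategoryTheory.Limits

universe w w' u v

/-! ### Amalgamation and joint embedding -/

/-- The amalgamation property: every diagram of shape `• ← • → •` has a cocone. -/
def HasAP (C : Type u) [Category.{v} C] : Prop :=
  ∀ F : WalkingSpan ⥤ C, Nonempty (Cocone F)

/-- The joint embedding property: every diagram of finite discrete shape has a cocone.
The empty shape is included, so a category with this property is nonempty. -/
def HasJEP (C : Type u) [Category.{v} C] : Prop :=
  ∀ (n : ℕ) (F : Discrete (Fin n) ⥤ C), Nonempty (Cocone F)

/-- Every `I`-shaped diagram in a category with the AP and the JEP has a cocone. -/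
def CoconesFromAPJEP (I : Type w) [Category.{w'} I] : Prop :=
  ∀ (C : Type u) [Category.{v} C], HasAP C → HasJEP C → ∀ F : I ⥤ C, Nonempty (Cocone F)

/-- Every `I`-shaped diagram in a category with the AP has a cocone. -/
def CoconesFromAP (I : Type w) [Category.{w'} I] : Prop :=
  ∀ (C : Type u) [Category.{v} C], HasAP C → ∀ F : I ⥤ C, Nonempty (Cocone F)

/-! ### Inverse categories and the left fundamental inverse category -/

/-- `g` is a pseudoinverse of `f`. -/
def IsPseudoinverse {C : Type u} [Category.{v} C] {X Y : C} (f : X ⟶ Y) (g : Y ⟶ X) : Prop :=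
  f ≫ g ≫ f = f ∧ g ≫ f ≫ g = g

/-- An inverse category: every morphism has a unique pseudoinverse. -/
def IsInverseCategory (C : Type u) [Category.{v} C] : Prop :=
  ∀ ⦃X Y : C⦄ (f : X ⟶ Y), ∃! g : Y ⟶ X, IsPseudoinverse f g

/-- An idempotent category: every endomorphism is idempotent. -/
def IsIdempotentCategory (C : Type u) [Category.{v} C] : Prop :=
  ∀ (X : C) (f : X ⟶ X), f ≫ f = f

/-- Formal expressions built from the morphisms of `I` with identities, composition (in
diagrammatic order) and formal pseudoinverses. -/
inductive InvTerm (I : Type w) [Category.{w'} I] : I → I → Type (max w w')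
  | of {X Y : I} (i : X ⟶ Y) : InvTerm I X Y
  | id (X : I) : InvTerm I X X
  | comp {X Y Z : I} (f : InvTerm I X Y) (g : InvTerm I Y Z) : InvTerm I X Z
  | inv {X Y : I} (f : InvTerm I X Y) : InvTerm I Y X

/-- The least congruence on formal expressions that contains the laws of inverse categories, the
relations that hold in `I`, and the relations `i⁻¹ ∘ i = 1` for the morphisms `i` of `I`. -/
inductive InvTerm.Rel {I : Type w} [Category.{w'} I] :
    ∀ {X Y : I}, InvTerm I X Y → InvTerm I X Y → Prop
  | refl {X Y : I} (f : InvTerm I X Y) : Rel f f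
  | symm {X Y : I} {f g : InvTerm I X Y} : Rel f g → Rel g f
  | trans {X Y : I} {f g h : InvTerm I X Y} : Rel f g → Rel g h → Rel f h
  | comp_congr {X Y Z : I} {f f' : InvTerm I X Y} {g g' : InvTerm I Y Z} :
      Rel f f' → Rel g g' → Rel (f.comp g) (f'.comp g')
  | inv_congr {X Y : I} {f f' : InvTerm I X Y} : Rel f f' → Rel f.inv f'.inv
  | id_comp {X Y : I} (f : InvTerm I X Y) : Rel ((InvTerm.id X).comp f) f
  | comp_id {X Y : I} (f : InvTerm I X Y) : Rel (f.comp (InvTerm.id Y)) f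
  | assoc {W X Y Z : I} (f : InvTerm I W X) (g : InvTerm I X Y) (h : InvTerm I Y Z) :
      Rel ((f.comp g).comp h) (f.comp (g.comp h))
  | inv_inv {X Y : I} (f : InvTerm I X Y) : Rel f.inv.inv f
  | inv_comp {X Y Z : I} (f : InvTerm I X Y) (g : InvTerm I Y Z) :
      Rel (f.comp g).inv (g.inv.comp f.inv)
  | regular {X Y : I} (f : InvTerm I X Y) : Rel (f.comp (f.inv.comp f)) f
  | idem_comm {X Y Z : I} (f : InvTerm I X Y) (g : InvTerm I X Z) :
      Rel ((f.comp f.inv).comp (g.comp g.inv)) ((g.comp g.inv).comp (f.comp f.inv))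
  | of_id (X : I) : Rel (InvTerm.of (𝟙 X)) (InvTerm.id X)
  | of_comp {X Y Z : I} (i : X ⟶ Y) (j : Y ⟶ Z) :
      Rel (InvTerm.of (i ≫ j)) ((InvTerm.of i).comp (InvTerm.of j))
  | of_mono {X Y : I} (i : X ⟶ Y) : Rel ((InvTerm.of i).comp (InvTerm.of i).inv) (InvTerm.id X)

/-- The congruence as a setoid on each set of parallel expressions. -/
def InvTerm.setoid {I : Type w} [Category.{w'} I] (X Y : I) : Setoid (InvTerm I X Y) where
  r := InvTerm.Rel
  iseqv := ⟨.refl, .symm, .trans⟩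

/-- The objects of the left fundamental inverse category of `I`: those of `I`. -/
structure LeftFundInv (I : Type w) [Category.{w'} I] : Type w where
  as : I

/-- The left fundamental inverse category of `I`: the inverse category freely generated by `I`
such that every morphism of `I` becomes monic. -/
instance LeftFundInv.category (I : Type w) [Category.{w'} I] :
    Category.{max w w'} (LeftFundInv I) where
  Hom X Y := _root_.Quotient (InvTerm.setoid X.as Y.as)
  id X := Quotient.mk _ (InvTerm.id X.as)
  comp f g := Quotient.map₂ InvTerm.comp (fun _ _ h _ _ h' => InvTerm.Rel.comp_congr h h') f g
  id_comp f := Quotient.inductionOn f fun f => Quotient.sound (InvTerm.Rel.id_comp f)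
  comp_id f := Quotient.inductionOn f fun f => Quotient.sound (InvTerm.Rel.comp_id f)
  assoc f g h := Quotient.inductionOn₃ f g h fun f g h => Quotient.sound (InvTerm.Rel.assoc f g h)

/-- The canonical functor from `I` to its left fundamental inverse category. -/
def LeftFundInv.η (I : Type w) [Category.{w'} I] : I ⥤ LeftFundInv I where
  obj X := ⟨X⟩
  map i := Quotient.mk _ (InvTerm.of i)
  map_id X := Quotient.sound (InvTerm.Rel.of_id X)
  map_comp i j := Quotient.sound (InvTerm.Rel.of_comp i j)

/-- `I` is upward-simply-connected if its left fundamental inverse category is idempotent. -/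
def UpwardSimplyConnected (I : Type w) [Category.{w'} I] : Prop :=
  IsIdempotentCategory (LeftFundInv I)

/-! ### The universal property of the left fundamental inverse category -/

/-- In an inverse category, idempotents commute. -/
theorem IsInverseCategory.idem_comm {C : Type u} [Category.{v} C] (hC : IsInverseCategory C)
    {X : C} (e f : X ⟶ X) (he : e ≫ e = e) (hf : f ≫ f = f) : e ≫ f = f ≫ e := by
  have key : ∀ e f : X ⟶ X, e ≫ e = e → f ≫ f = f → (e ≫ f) ≫ (e ≫ f) = e ≫ f := by
    intro e f he hf
    have he' : ∀ {Z : C} (h : X ⟶ Z), e ≫ e ≫ h = e ≫ h := fun h => by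
      rw [← Category.assoc, he]
    have hf' : ∀ {Z : C} (h : X ⟶ Z), f ≫ f ≫ h = f ≫ h := fun h => by
      rw [← Category.assoc, hf]
    obtain ⟨x, ⟨h1, h2⟩, hu⟩ := hC (e ≫ f)
    simp only [Category.assoc] at h1 h2
    have h2' : ∀ {Z : C} (h : X ⟶ Z), x ≫ e ≫ f ≫ x ≫ h = x ≫ h := fun h => by
      have := congrArg (· ≫ h) h2
      simpa only [Category.assoc] using this
    have hx : f ≫ x ≫ e = x := by
      refine hu _ ⟨?_, ?_⟩
      · simp only [Category.assoc, hf', he']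
        exact h1
      · simp only [Category.assoc, hf', he', h2']
    have hxx : x ≫ x = x := by
      calc x ≫ x = (f ≫ x ≫ e) ≫ (f ≫ x ≫ e) := by rw [hx]
        _ = f ≫ x ≫ e := by simp only [Category.assoc, h2']
        _ = x := hx
    obtain ⟨y, _, hy⟩ := hC x
    have a1 : e ≫ f = y := hy _ ⟨by simpa only [Category.assoc] using h2,
      by simpa only [Category.assoc] using h1⟩
    have a2 : x = y := hy _ ⟨by rw [hxx, hxx], by rw [hxx, hxx]⟩
    rw [a1, ← a2, hxx]
  have h1 := key e f he hf
  have h2 := key f e hf he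
  have he' : ∀ {Z : C} (h : X ⟶ Z), e ≫ e ≫ h = e ≫ h := fun h => by
    rw [← Category.assoc, he]
  have hf' : ∀ {Z : C} (h : X ⟶ Z), f ≫ f ≫ h = f ≫ h := fun h => by
    rw [← Category.assoc, hf]
  simp only [Category.assoc] at h1 h2
  obtain ⟨y, _, hy⟩ := hC (e ≫ f)
  have a1 : e ≫ f = y := hy _ ⟨by simp only [Category.assoc, h1], by simp only [Category.assoc, h1]⟩
  have a2 : f ≫ e = y := hy _ ⟨by simp only [Category.assoc, hf', he', h1],
    by simp only [Category.assoc, hf', he', h2]⟩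
  rw [a1, a2]

/-- The left fundamental inverse category is an inverse category. -/
theorem LeftFundInv.isInverseCategory (I : Type w) [Category.{w'} I] :
    IsInverseCategory (LeftFundInv I) := by
  let star : ∀ {X Y : LeftFundInv I}, (X ⟶ Y) → (Y ⟶ X) := fun f =>
    Quotient.map InvTerm.inv (fun _ _ h => InvTerm.Rel.inv_congr h) f
  have reg : ∀ {X Y : LeftFundInv I} (f : X ⟶ Y), f ≫ star f ≫ f = f := fun f =>
    Quotient.inductionOn f fun f => Quotient.sound (InvTerm.Rel.regular f)
  have inv : ∀ {X Y : LeftFundInv I} (f : X ⟶ Y), star (star f) = f := fun f =>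
    Quotient.inductionOn f fun f => Quotient.sound (InvTerm.Rel.inv_inv f)
  have invc : ∀ {X Y Z : LeftFundInv I} (f : X ⟶ Y) (g : Y ⟶ Z),
      star (f ≫ g) = star g ≫ star f := fun f g =>
    Quotient.inductionOn₂ f g fun f g => Quotient.sound (InvTerm.Rel.inv_comp f g)
  have comm : ∀ {X Y Z : LeftFundInv I} (f : X ⟶ Y) (g : X ⟶ Z),
      (f ≫ star f) ≫ (g ≫ star g) = (g ≫ star g) ≫ (f ≫ star f) := fun f g =>
    Quotient.inductionOn₂ f g fun f g => Quotient.sound (InvTerm.Rel.idem_comm f g)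
  have reg' : ∀ {X Y : LeftFundInv I} (f : X ⟶ Y), star f ≫ f ≫ star f = star f := fun f => by
    simpa only [inv] using reg (star f)
  -- idempotents are self-adjoint
  have sa : ∀ {X : LeftFundInv I} (e : X ⟶ X), e ≫ e = e → star e = e := by
    intro X e he
    have hs : star e ≫ star e = star e := by rw [← invc, he]
    have h1 := comm e (star e)
    simp only [inv, Category.assoc] at h1
    have h2 : e ≫ star e = star e ≫ e := by
      have hse : ∀ {Z : LeftFundInv I} (h : X ⟶ Z), star e ≫ star e ≫ h = star e ≫ h :=
        fun h => by rw [← Category.assoc, hs]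
      have hee : ∀ {Z : LeftFundInv I} (h : X ⟶ Z), e ≫ e ≫ h = e ≫ h :=
        fun h => by rw [← Category.assoc, he]
      rw [hse, hee] at h1
      rw [reg] at h1
      rw [reg'] at h1
      have h3 : star e = e := h1.symm
      rw [h3]
    calc star e = star e ≫ e ≫ star e := (reg' e).symm
      _ = star e ≫ star e ≫ e := by rw [h2]
      _ = e ≫ star e := by rw [← Category.assoc, hs, h2]
      _ = (e ≫ e) ≫ star e := by rw [he]
      _ = e ≫ star e ≫ e := by rw [Category.assoc, h2]
      _ = e := reg e
  have comm' : ∀ {X : LeftFundInv I} (e f : X ⟶ X), e ≫ e = e → f ≫ f = f → e ≫ f = f ≫ e := by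
    intro X e f he hf
    have := comm e f
    rwa [sa e he, sa f hf, he, hf] at this
  have uniq : ∀ {X Y : LeftFundInv I} (f : X ⟶ Y) (g h : Y ⟶ X), IsPseudoinverse f g →
      IsPseudoinverse f h → g = h := by
    rintro X Y f g h ⟨g1, g2⟩ ⟨h1, h2⟩
    have i1 : (f ≫ g) ≫ (f ≫ g) = f ≫ g := by rw [Category.assoc, g2]
    have i2 : (f ≫ h) ≫ (f ≫ h) = f ≫ h := by rw [Category.assoc, h2]
    have i3 : (g ≫ f) ≫ (g ≫ f) = g ≫ f := by rw [Category.assoc, g1]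
    have i4 : (h ≫ f) ≫ (h ≫ f) = h ≫ f := by rw [Category.assoc, h1]
    have c1 := comm' _ _ i1 i2
    have c2 := comm' _ _ i3 i4
    have hfgh : f ≫ g = f ≫ h := by
      calc f ≫ g = (f ≫ h ≫ f) ≫ g := by rw [h1]
        _ = (f ≫ h) ≫ (f ≫ g) := by simp only [Category.assoc]
        _ = (f ≫ g) ≫ (f ≫ h) := c1.symm
        _ = (f ≫ g ≫ f) ≫ h := by simp only [Category.assoc]
        _ = f ≫ h := by rw [g1]
    have hgfh : g ≫ f = h ≫ f := by
      calc g ≫ f = g ≫ (f ≫ h ≫ f) := by rw [h1]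
        _ = (g ≫ f) ≫ (h ≫ f) := by simp only [Category.assoc]
        _ = (h ≫ f) ≫ (g ≫ f) := c2
        _ = h ≫ (f ≫ g ≫ f) := by simp only [Category.assoc]
        _ = h ≫ f := by rw [g1]
    calc g = g ≫ f ≫ g := g2.symm
      _ = g ≫ f ≫ h := by rw [hfgh]
      _ = (g ≫ f) ≫ h := by rw [Category.assoc]
      _ = (h ≫ f) ≫ h := by rw [hgfh]
      _ = h := by rw [Category.assoc, h2]
  intro X Y f
  exact ⟨star f, ⟨reg f, reg' f⟩, fun g hg => uniq f g _ hg ⟨reg f, reg' f⟩⟩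

/-- Every morphism of `I` becomes (split) monic in the left fundamental inverse category. -/
theorem LeftFundInv.η_mono (I : Type w) [Category.{w'} I] {X Y : I} (i : X ⟶ Y)
    (g : (LeftFundInv.η I).obj Y ⟶ (LeftFundInv.η I).obj X)
    (hg : IsPseudoinverse ((LeftFundInv.η I).map i) g) :
    (LeftFundInv.η I).map i ≫ g = 𝟙 _ := by
  let s : (LeftFundInv.η I).obj Y ⟶ (LeftFundInv.η I).obj X :=
    Quotient.mk (InvTerm.setoid Y X) (InvTerm.of i).inv
  have hs : (LeftFundInv.η I).map i ≫ s = 𝟙 _ := Quotient.sound (InvTerm.Rel.of_mono i)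
  have : g = s := (LeftFundInv.isInverseCategory I _).unique hg
    ⟨by rw [← Category.assoc, hs, Category.id_comp], by rw [hs, Category.comp_id]⟩
  rw [this, hs]

/-- The universal property: every functor from `I` to an inverse category that turns all morphisms
into (split) monomorphisms extends uniquely along `η`. -/
theorem LeftFundInv.existsUnique_lift (I : Type w) [Category.{w'} I] (C : Type u) [Category.{v} C]
    (hC : IsInverseCategory C) (F : I ⥤ C)
    (hF : ∀ {X Y : I} (i : X ⟶ Y) (g : F.obj Y ⟶ F.obj X),
      IsPseudoinverse (F.map i) g → F.map i ≫ g = 𝟙 _) :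
    ∃! G : LeftFundInv I ⥤ C, LeftFundInv.η I ⋙ G = F := by
  choose star hstar hu using fun {X Y : C} (f : X ⟶ Y) => hC f
  have reg : ∀ {X Y : C} (f : X ⟶ Y), f ≫ star f ≫ f = f := fun f => (hstar f).1
  have reg' : ∀ {X Y : C} (f : X ⟶ Y), star f ≫ f ≫ star f = star f := fun f => (hstar f).2
  have inv : ∀ {X Y : C} (f : X ⟶ Y), star (star f) = f := fun f =>
    (hu (star f) f ⟨reg' f, reg f⟩).symm
  have idl : ∀ {X Y : C} (f : X ⟶ Y), (f ≫ star f) ≫ (f ≫ star f) = f ≫ star f := fun f => by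
    rw [Category.assoc, reg']
  have idr : ∀ {X Y : C} (f : X ⟶ Y), (star f ≫ f) ≫ (star f ≫ f) = star f ≫ f := fun f => by
    rw [Category.assoc, reg]
  have invc : ∀ {X Y Z : C} (f : X ⟶ Y) (g : Y ⟶ Z), star (f ≫ g) = star g ≫ star f := by
    intro X Y Z f g
    have c := hC.idem_comm _ _ (idr f) (idl g)
    refine (hu _ _ ⟨?_, ?_⟩).symm
    · calc (f ≫ g) ≫ (star g ≫ star f) ≫ f ≫ g
          = f ≫ ((g ≫ star g) ≫ (star f ≫ f)) ≫ g := by simp only [Category.assoc]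
        _ = f ≫ ((star f ≫ f) ≫ (g ≫ star g)) ≫ g := by rw [c]
        _ = (f ≫ star f ≫ f) ≫ (g ≫ star g ≫ g) := by simp only [Category.assoc]
        _ = f ≫ g := by rw [reg, reg]
    · calc (star g ≫ star f) ≫ (f ≫ g) ≫ star g ≫ star f
          = star g ≫ ((star f ≫ f) ≫ (g ≫ star g)) ≫ star f := by simp only [Category.assoc]
        _ = star g ≫ ((g ≫ star g) ≫ (star f ≫ f)) ≫ star f := by rw [c]
        _ = (star g ≫ g ≫ star g) ≫ (star f ≫ f ≫ star f) := by simp only [Category.assoc]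
        _ = star g ≫ star f := by rw [reg', reg']
  let ev : ∀ {X Y : I}, InvTerm I X Y → (F.obj X ⟶ F.obj Y) := fun {X Y} t =>
    InvTerm.rec (motive := fun X Y _ => F.obj X ⟶ F.obj Y) (fun i => F.map i) (fun X => 𝟙 _)
      (fun _ _ f g => f ≫ g) (fun _ f => star f) t
  have evs : ∀ {X Y : I} (s t : InvTerm I X Y), InvTerm.Rel s t → ev s = ev t := by
    intro X Y s t h
    induction h with
    | refl f => rfl
    | symm _ ih => exact ih.symm
    | trans _ _ ih ih' => exact ih.trans ih'
    | comp_congr _ _ ih ih' => exact congrArg₂ (· ≫ ·) ih ih'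
    | inv_congr _ ih => exact congrArg (fun f => star f) ih
    | id_comp f => exact Category.id_comp _
    | comp_id f => exact Category.comp_id _
    | assoc f g h => exact Category.assoc _ _ _
    | inv_inv f => exact inv _
    | inv_comp f g => exact invc _ _
    | regular f => exact reg _
    | idem_comm f g => exact hC.idem_comm _ _ (idl _) (idl _)
    | of_id X => exact F.map_id X
    | of_comp i j => exact F.map_comp i j
    | of_mono i => exact hF i _ (hstar _)
  let G : LeftFundInv I ⥤ C :=
    { obj := fun X => F.obj X.as
      map := fun {X Y} f => Quotient.lift (s := InvTerm.setoid X.as Y.as)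
        (fun t => ev t) (fun s t h => evs s t h) f
      map_id := fun X => rfl
      map_comp := fun f g => Quotient.inductionOn₂ f g fun f g => rfl }
  refine ⟨G, rfl, ?_⟩
  rintro H rfl
  let cl : ∀ {X Y : I}, InvTerm I X Y → ((⟨X⟩ : LeftFundInv I) ⟶ ⟨Y⟩) :=
    fun {X Y} t => Quotient.mk (InvTerm.setoid X Y) t
  have key : ∀ {X Y : I} (t : InvTerm I X Y), H.map (cl t) = ev t := by
    intro X Y t
    induction t with
    | of i => rfl
    | id X => exact H.map_id ⟨X⟩
    | comp f g ihf ihg =>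
      exact (H.map_comp (cl f) (cl g)).trans (congrArg₂ (· ≫ ·) ihf ihg)
    | inv f ih =>
      have h1 : cl f ≫ cl f.inv ≫ cl f = cl f := Quotient.sound (InvTerm.Rel.regular f)
      have h2 : cl f.inv ≫ cl f ≫ cl f.inv = cl f.inv := Quotient.sound
        (.trans (.comp_congr (.refl _) (.comp_congr (.symm (.inv_inv f)) (.refl _)))
          (InvTerm.Rel.regular f.inv))
      have h3 : H.map (cl f.inv) = star (H.map (cl f)) :=
        hu _ _ ⟨by rw [← H.map_comp, ← H.map_comp, h1], by rw [← H.map_comp, ← H.map_comp, h2]⟩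
      exact h3.trans (congrArg (fun f => star f) ih)
  refine CategoryTheory.Functor.hext (fun X => rfl) ?_
  rintro ⟨X⟩ ⟨Y⟩ f
  exact heq_of_eq (Quotient.inductionOn f fun t => key t)

/-! ### The monic reflection -/

/-- The least congruence on `I` whose quotient category is monic. -/
def monicRel (I : Type w) [Category.{w'} I] : HomRel I := fun X Y f g =>
  ∀ r : HomRel I, Congruence r →
    (∀ ⦃A B : CategoryTheory.Quotient r⦄ (h : A ⟶ B), Mono h) → @r X Y f g

/-- The monic reflection of `I`. -/
abbrev MonicReflection (I : Type w) [Category.{w'} I] : Type w :=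
  CategoryTheory.Quotient (monicRel I)

/-! ### Tree-like and forest-like posets -/

/-- The disjoint union of the posets `K k` with one further point adjoined, which lies below the
upward-closed subset `U k` of each `K k` (and below no other point of the `K k`). -/
structure AdjoinPoint {n : ℕ} (K : Fin n → Type w) [∀ k, PartialOrder (K k)]
    (U : ∀ k, UpperSet (K k)) : Type w where
  toOption : Option (Σ k, K k)

instance AdjoinPoint.partialOrder {n : ℕ} (K : Fin n → Type w) [∀ k, PartialOrder (K k)]
    (U : ∀ k, UpperSet (K k)) : PartialOrder (AdjoinPoint K U) where
  le a b := match a, b with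
    | ⟨none⟩, ⟨none⟩ => True
    | ⟨none⟩, ⟨some y⟩ => y.2 ∈ U y.1
    | ⟨some _⟩, ⟨none⟩ => False
    | ⟨some x⟩, ⟨some y⟩ => x ≤ y
  le_refl := by rintro ⟨_ | x⟩ <;> simp
  le_trans := by
    rintro ⟨_ | x⟩ ⟨_ | y⟩ ⟨_ | z⟩ h1 h2 <;> try trivial
    · obtain ⟨k, y, z, hyz⟩ := h2
      exact (U k).upper hyz h1
    · exact le_trans (α := Σ k, K k) h1 h2
  le_antisymm := by
    rintro ⟨_ | x⟩ ⟨_ | y⟩ h1 h2 <;> try trivial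
    exact congrArg (fun s => AdjoinPoint.mk (some s)) (le_antisymm (α := Σ k, K k) h1 h2)

/-- Finite tree-like posets, up to isomorphism: given finitely many tree-like posets `K k` and
connected (in particular nonempty) upward-closed subsets `U k` of them, the disjoint union of the
`K k` with a point adjoined below the `U k` is tree-like. -/
inductive TreeLike : ∀ (P : Type w) [PartialOrder P], Prop
  | adjoin {n : ℕ} (K : Fin n → Type w) [∀ k, PartialOrder (K k)] (U : ∀ k, UpperSet (K k))
      (hK : ∀ k, TreeLike (K k)) (hU : ∀ k, CategoryTheory.IsConnected {x : K k // x ∈ U k})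
      (P : Type w) [PartialOrder P] (e : P ≃o AdjoinPoint K U) : TreeLike P

/-- Finite forest-like posets: finite disjoint unions of tree-like posets. -/
def ForestLike (P : Type w) [PartialOrder P] : Prop :=
  ∃ (n : ℕ) (K : Fin n → Type w) (_ : ∀ k, PartialOrder (K k)),
    (∀ k, TreeLike (K k)) ∧ Nonempty (P ≃o Σ k, K k)

/-! ### Explicitly given finite categories -/

/-- Finite data describing a finite category: the number of objects, the list of the morphisms
(each given by the numbers of its source and of its target), and a composition table. -/
abbrev CatTable : Type := ℕ × List (ℕ × ℕ) × List (List ℕ)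

/-- `c` is a description of the category `I`: after a numbering of the objects and of the morphisms
of `I`, the list in `c` gives the source and the target of each morphism, and for composable
morphisms `f : X ⟶ Y` and `g : Y ⟶ Z` the entry of the table in the row of `f` and the column of `g`
is the number of the composite (other entries are arbitrary or absent). -/
structure CatTable.Presentation (c : CatTable) (I : Type w) [Category.{w'} I] where
  obj : I ≃ Fin c.1
  arr : (Σ X Y : I, X ⟶ Y) ≃ Fin c.2.1.length
  endpoints : ∀ {X Y : I} (f : X ⟶ Y), c.2.1.get (arr ⟨X, Y, f⟩) = ((obj X : ℕ), (obj Y : ℕ))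
  comp : ∀ {X Y Z : I} (f : X ⟶ Y) (g : Y ⟶ Z),
    (c.2.2[(arr ⟨X, Y, f⟩ : ℕ)]?.bind fun row => row[(arr ⟨Y, Z, g⟩ : ℕ)]?) =
      some (arr ⟨X, Z, f ≫ g⟩ : ℕ)

/-- Every category with finitely many objects and morphisms has a description. -/
theorem CatTable.exists_presentation (I : Type w) [Category.{w'} I] [Finite I]
    [∀ X Y : I, Finite (X ⟶ Y)] : ∃ c : CatTable, Nonempty (c.Presentation I) := by
  classical
  obtain ⟨n, ⟨eo⟩⟩ := Finite.exists_equiv_fin I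
  obtain ⟨m, ⟨ea⟩⟩ := Finite.exists_equiv_fin (Σ X Y : I, X ⟶ Y)
  let ends : (Σ X Y : I, X ⟶ Y) → ℕ × ℕ := fun p => (eo p.1, eo p.2.1)
  let num : (Σ X Y : I, X ⟶ Y) → (Σ X Y : I, X ⟶ Y) → ℕ := fun p q =>
    if h : p.2.1 = q.1 then ea ⟨p.1, q.2.1, p.2.2 ≫ eqToHom h ≫ q.2.2⟩ else 0
  let arrows : List (ℕ × ℕ) := List.ofFn fun a : Fin m => ends (ea.symm a)
  have hm : m = arrows.length := (List.length_ofFn).symm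
  let table : List (List ℕ) := List.ofFn fun a => List.ofFn fun b => num (ea.symm a) (ea.symm b)
  refine ⟨(n, arrows, table), ⟨⟨eo, ea.trans (finCongr hm), ?_, ?_⟩⟩⟩
  · intro X Y f
    have h : arrows.get (finCongr hm (ea ⟨X, Y, f⟩)) = ends (ea.symm (ea ⟨X, Y, f⟩)) := by
      simp [arrows]
    rw [Equiv.symm_apply_apply] at h
    exact h
  · intro X Y Z f g
    have h : (table[(ea ⟨X, Y, f⟩ : ℕ)]?.bind fun row => row[(ea ⟨Y, Z, g⟩ : ℕ)]?) =
        some (num (ea.symm (ea ⟨X, Y, f⟩)) (ea.symm (ea ⟨Y, Z, g⟩))) := by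
      simp [table, -Equiv.symm_apply_apply]
    rw [Equiv.symm_apply_apply, Equiv.symm_apply_apply] at h
    simpa [num] using h

-- Everything is reduced to diagrams of small sets and injections. For finite `I`, and `N ≥ 2` at
-- least the number of morphisms, `UpwardSimplyConnected.tfae` proves a cycle through four
-- conditions: (1) `I` is upward-simply-connected; (2) `I`-shaped diagrams of injections between
-- sets of size at most `N` have cocones of injections; (3) the monic reflection is thin with
-- forest-like skeleton; (4) cocones follow from the AP and the JEP.
--
-- (1 → 2) Formal expressions act on a diagram of injections as partial injections. If their
-- endomorphisms are idempotent, no zigzag joins two distinct elements of one set, so each set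
-- embeds in the quotient of all elements by zigzags. (2 → 3) Representable diagrams on the monic
-- reflection force thinness (`HasBoundedCocones.isThin`). Two-element fibres twisted by a cocycle
-- mod 2 detect a disconnected `U k`, so the skeleton decomposes recursively into trees
-- (`TreeLike.of_hasDoubleCoverCocones`). (3 → 4) Modulo eventual equality a category with the AP
-- becomes monic, so a diagram in it factors through the monic reflection. Over a tree a cocone is
-- built by finite amalgamation, and the JEP joins the trees. Finitely many equations then lift back
-- from the quotient. (4 → 1) Test the hypothesis on the one-object category of injections `ℕ → ℕ`,
-- with the representable diagrams of `LeftFundInv I` padded to countably infinite sets.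
--
-- Without the JEP the only extra condition is connectedness (`coconesFromAP_iff`). Condition (2) is
-- finitely checkable: diagrams and cocones are coded as digits of bounded natural numbers, which
-- gives primitive recursive decision procedures.

universe t

/-! ### Posets all of whose double covers are trivial -/

/-- Every diagram of two-element sets and bijections, indexed by an upward-closed subset of `P`,
has a cocone of injections. -/
def HasDoubleCoverCocones (P : Type w) [PartialOrder P] : Prop :=
  ∀ A : Set P, IsUpperSet A → ∀ σ : P → P → Bool,
    (∀ x ∈ A, ∀ y z, x ≤ y → y ≤ z → σ x z = xor (σ x y) (σ y z)) →
    ∃ φ : P → Bool → ℕ, ∀ x ∈ A, Function.Injective (φ x) ∧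
      ∀ y, x ≤ y → ∀ b, φ y (xor b (σ x y)) = φ x b

/-- A cover of an upward-closed part is a cover of the whole poset with empty fibres elsewhere. This
is why the definition quantifies over upper sets `A`: the property must pass to components in the
induction below. -/
theorem HasDoubleCoverCocones.of_embedding {P Q : Type w} [PartialOrder P] [PartialOrder Q]
    (h : HasDoubleCoverCocones P) (j : Q ↪o P) (hj : IsUpperSet (Set.range j)) :
    HasDoubleCoverCocones Q := by
  intro A hA σ hσ
  rcases isEmpty_or_nonempty Q with hQ | hQ
  · exact ⟨fun _ _ => 0, fun x => hQ.elim x⟩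
  have hinv : ∀ x, Function.invFun j (j x) = x := Function.leftInverse_invFun j.injective
  obtain ⟨φ, hφ⟩ := h (j '' A) (by
    rintro _ y hxy ⟨a, ha, rfl⟩
    obtain ⟨b, rfl⟩ := hj hxy ⟨a, rfl⟩
    exact ⟨b, hA (j.le_iff_le.1 hxy) ha, rfl⟩)
    (fun x y => σ (Function.invFun j x) (Function.invFun j y)) (by
    rintro _ ⟨a, ha, rfl⟩ y z hxy hyz
    obtain ⟨b, rfl⟩ := hj hxy ⟨a, rfl⟩
    obtain ⟨c, rfl⟩ := hj hyz ⟨b, rfl⟩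
    simp only [hinv]
    exact hσ a ha b c (j.le_iff_le.1 hxy) (j.le_iff_le.1 hyz))
  refine ⟨fun x => φ (j x), fun x hx => ⟨(hφ _ ⟨x, hx, rfl⟩).1, fun y hxy b => ?_⟩⟩
  simpa only [hinv] using (hφ _ ⟨x, hx, rfl⟩).2 (j y) (j.le_iff_le.2 hxy) b

/-- The set of connected components of a poset. -/
abbrev PosetComponents (P : Type w) [PartialOrder P] : Type w := Quot ((· ≤ ·) : P → P → Prop)

/-- A connected component of a poset. -/
abbrev PosetComponent (P : Type w) [PartialOrder P] (i : PosetComponents P) : Type w :=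
  {x : P // Quot.mk _ x = i}

theorem PosetComponent.isConnected {P : Type w} [PartialOrder P] (i : PosetComponents P) :
    CategoryTheory.IsConnected (PosetComponent P i) := by
  obtain ⟨x, rfl⟩ := Quot.exists_rep i
  have : Nonempty (PosetComponent P (Quot.mk _ x)) := ⟨⟨x, rfl⟩⟩
  refine IsConnected.of_induct (j₀ := ⟨x, rfl⟩) fun p h0 hp j => ?_
  let f : P → Prop := fun y => ∃ h : Quot.mk _ y = Quot.mk _ x, (⟨y, h⟩ : PosetComponent P _) ∈ p
  have hf : ∀ y z : P, y ≤ z → f y = f z := by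
    intro y z hyz
    have hq : (Quot.mk _ y : PosetComponents P) = Quot.mk _ z := Quot.sound hyz
    refine propext ⟨?_, ?_⟩
    · rintro ⟨h, hm⟩
      exact ⟨hq.symm.trans h, (hp (homOfLE (show (⟨y, h⟩ : PosetComponent P _) ≤ ⟨z, _⟩ from hyz))).1 hm⟩
    · rintro ⟨h, hm⟩
      exact ⟨hq.trans h, (hp (homOfLE (show (⟨y, _⟩ : PosetComponent P _) ≤ ⟨z, h⟩ from hyz))).2 hm⟩
  have hx : Quot.lift f hf (Quot.mk _ x) := ⟨rfl, h0⟩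
  rw [← j.2] at hx
  exact hx.2

/-- Comparable elements of a disjoint union of components. -/
theorem PosetComponent.sigma_le_iff {P : Type w} [PartialOrder P] {n : ℕ}
    (e : PosetComponents P ≃ Fin n) (a b : Σ k, PosetComponent P (e.symm k)) :
    a ≤ b ↔ a.2.1 ≤ b.2.1 := by
  obtain ⟨k, y, hy⟩ := a
  obtain ⟨l, z, hz⟩ := b
  constructor
  · rintro ⟨_, _, _, h⟩
    exact h
  · intro h
    have : k = l := e.symm.injective (by rw [← hy, ← hz]; exact Quot.sound h)
    subst this
    exact Sigma.LE.fiber _ _ _ h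

/-- A finite poset is the disjoint union of its components. -/
noncomputable def PosetComponent.sigmaIso {P : Type w} [PartialOrder P] {n : ℕ}
    (e : PosetComponents P ≃ Fin n) : (Σ k, PosetComponent P (e.symm k)) ≃o P where
  toEquiv := Equiv.ofBijective (fun a => a.2.1) <| by
    constructor
    · rintro ⟨k, y, hy⟩ ⟨l, z, hz⟩ (rfl : y = z)
      have : k = l := e.symm.injective (hy.symm.trans hz)
      subst this
      rfl
    · intro x
      exact ⟨⟨e (Quot.mk _ x), x, by simp⟩, rfl⟩
  map_rel_iff' {a b} := (sigma_le_iff e a b).symm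

/-- A poset with a minimal element is obtained by adjoining this element to the components of its
complement. -/
theorem TreeLike.of_isMin {P : Type w} [PartialOrder P] [Finite P] (p : P) (hp : IsMin p)
    (hK : ∀ i, TreeLike (PosetComponent {x : P // x ≠ p} i))
    (hU : ∀ i, CategoryTheory.IsConnected
      {x : PosetComponent {x : P // x ≠ p} i // p ≤ x.1.1}) :
    TreeLike P := by
  obtain ⟨n, ⟨e⟩⟩ := Finite.exists_equiv_fin (PosetComponents {x : P // x ≠ p})
  let K : Fin n → Type w := fun k => PosetComponent {x : P // x ≠ p} (e.symm k)
  let U : ∀ k, UpperSet (K k) := fun k => ⟨{x | p ≤ x.1.1}, fun x y hxy hx => le_trans hx hxy⟩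
  let s := PosetComponent.sigmaIso e
  let g : AdjoinPoint K U → P := fun a => a.toOption.elim p fun x => (s x).1
  have hg : Function.Bijective g := by
    constructor
    · rintro ⟨_ | x⟩ ⟨_ | y⟩ h
      · rfl
      · exact absurd h.symm (s y).2
      · exact absurd h (s x).2
      · rw [s.injective (Subtype.ext h : s x = s y)]
    · intro x
      by_cases hx : x = p
      · exact ⟨⟨none⟩, hx.symm⟩
      · exact ⟨⟨some (s.symm ⟨x, hx⟩)⟩, by simp [g]⟩
  have hle : ∀ a b, g a ≤ g b ↔ a ≤ b := by
    rintro ⟨_ | x⟩ ⟨_ | y⟩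
    · exact iff_of_true le_rfl trivial
    · exact Iff.rfl
    · exact iff_of_false (fun h => (s x).2 (hp.eq_of_le h)) id
    · exact s.le_iff_le
  exact TreeLike.adjoin K U (fun k => hK _) (fun k => hU _) P
    (OrderIso.symm ⟨Equiv.ofBijective g hg, fun {a b} => hle a b⟩)

-- Remove a minimal point `p`. The components of the rest are upward closed in `P`, hence tree-like
-- by induction on cardinality. The part of a component above `p` is nonempty because `P` is
-- connected. If it split into two pieces, twisting the cover between `p` and one piece only would
-- give a cover with nontrivial monodromy, which has no cocone of injections.
open Classical in
theorem TreeLike.of_hasDoubleCoverCocones (P : Type w) [PartialOrder P] [Finite P]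
    [CategoryTheory.IsConnected P] (h : HasDoubleCoverCocones P) : TreeLike P := by
  induction hn : Nat.card P using Nat.strong_induction_on generalizing P with
  | _ n ih =>
  subst hn
  obtain ⟨p, -, hp⟩ := (Set.toFinite (Set.univ : Set P)).exists_minimal
    (@Set.univ_nonempty P IsConnected.is_nonempty)
  replace hp : IsMin p := fun x hx => hp (Set.mem_univ x) hx
  have hpe : ∀ {x}, x ≤ p → x = p := fun hx => (hp.eq_of_le hx)
  refine TreeLike.of_isMin p hp (fun i => ?_) (fun i => ?_)
  · have := PosetComponent.isConnected i
    refine ih _ ?_ _ (h.of_embedding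
      ((OrderEmbedding.subtype _).trans (OrderEmbedding.subtype _)) ?_) rfl
    · refine (Nat.card_le_card_of_injective _ Subtype.val_injective).trans_lt ?_
      exact Finite.card_subtype_lt (x := p) (by simp)
    · rintro _ y hxy ⟨⟨⟨x, hx⟩, hi⟩, rfl⟩
      have hy : y ≠ p := by
        rintro rfl
        exact hx (hpe hxy)
      exact ⟨⟨⟨y, hy⟩, (Quot.sound (show (⟨x, hx⟩ : {x : P // x ≠ p}) ≤ ⟨y, hy⟩
        from hxy)).symm.trans hi⟩, rfl⟩
  · have hne : Nonempty {x : PosetComponent {x : P // x ≠ p} i // p ≤ x.1.1} := by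
      by_contra hemp
      -- the component would be a union of components of `P`
      obtain ⟨⟨x, hx⟩, rfl⟩ := Quot.exists_rep i
      have := induct_on_objects {y : P | ∃ h : y ≠ p, (Quot.mk _ ⟨y, h⟩ :
        PosetComponents {x : P // x ≠ p}) = Quot.mk _ ⟨x, hx⟩} (j₀ := x) ⟨hx, rfl⟩ (by
          intro y z f
          have hyz : y ≤ z := leOfHom f
          constructor
          · rintro ⟨hy, hq⟩
            have hz : z ≠ p := by
              rintro rfl
              exact hy (hpe hyz)
            exact ⟨hz, hq ▸ (Quot.sound (show (⟨y, hy⟩ : {x : P // x ≠ p}) ≤ ⟨z, hz⟩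
              from hyz)).symm⟩
          · rintro ⟨hz, hq⟩
            have hy : y ≠ p := by
              rintro rfl
              exact hemp ⟨⟨⟨⟨z, hz⟩, hq⟩, hyz⟩⟩
            exact ⟨hy, hq ▸ Quot.sound (show (⟨y, hy⟩ : {x : P // x ≠ p}) ≤ ⟨z, hz⟩
              from hyz)⟩) p
      exact this.1 rfl
    obtain ⟨u₀⟩ := hne
    have : Nonempty {x : PosetComponent {x : P // x ≠ p} i // p ≤ x.1.1} := ⟨u₀⟩
    refine IsConnected.of_induct (j₀ := u₀) fun S h0 hS v => ?_
    by_contra hv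
    -- the double cover that is twisted along `S`
    let S' : Set P := {y | ∃ (h : y ≠ p) (h' : Quot.mk _ ⟨y, h⟩ = i) (h'' : p ≤ y),
      (⟨⟨⟨y, h⟩, h'⟩, h''⟩ : {x : PosetComponent {x : P // x ≠ p} i // p ≤ x.1.1}) ∈ S}
    have hpS' : p ∉ S' := fun ⟨h, _⟩ => h rfl
    have hS' : ∀ y z, p ≤ y → y ≠ p → y ≤ z → (y ∈ S' ↔ z ∈ S') := by
      intro y z hy hyp hyz
      have hz : z ≠ p := by
        rintro rfl
        exact hyp (hpe hyz)
      have hq : (Quot.mk _ ⟨y, hyp⟩ : PosetComponents {x : P // x ≠ p}) = Quot.mk _ ⟨z, hz⟩ :=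
        Quot.sound hyz
      constructor
      · rintro ⟨h1, h2, h3, h4⟩
        refine ⟨hz, hq ▸ h2, hy.trans hyz, ?_⟩
        exact (hS (homOfLE (show (⟨⟨⟨y, h1⟩, h2⟩, h3⟩ :
          {x : PosetComponent {x : P // x ≠ p} i // p ≤ x.1.1}) ≤ ⟨⟨⟨z, hz⟩, _⟩, _⟩ from hyz))).1 h4
      · rintro ⟨h1, h2, h3, h4⟩
        refine ⟨hyp, hq ▸ h2, hy, ?_⟩
        exact (hS (homOfLE (show (⟨⟨⟨y, hyp⟩, _⟩, hy⟩ :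
          {x : PosetComponent {x : P // x ≠ p} i // p ≤ x.1.1}) ≤ ⟨⟨⟨z, h1⟩, h2⟩, h3⟩ from hyz))).2 h4
    -- The cocycle law holds because, strictly above `p`, membership in `S'` is constant along `≤`,
    -- and all other edges are untwisted.
    obtain ⟨φ, hφ⟩ := h Set.univ isUpperSet_univ (fun x y => decide (x = p ∧ y ∈ S')) (by
      intro x _ y z hxy hyz
      by_cases hx : x = p
      · subst hx
        by_cases hy : y = x
        · subst hy
          simp [hpS']
        · simp [hy, hS' y z hxy hy hyz]
      · have hy : y ≠ p := by
          rintro rfl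
          exact hx (hpe hxy)
        simp [hx, hy])
    have hle : ∀ x y : P, x ≠ p → x ≤ y → φ y = φ x := by
      intro x y hx hxy
      funext b
      simpa [hx] using (hφ x trivial).2 y hxy b
    -- Inside the component nothing is twisted, so `φ` takes one value on all of it, in particular
    -- at points of both pieces.
    have hconst : φ u₀.1.1.1 = φ v.1.1.1 := by
      let L : PosetComponents {x : P // x ≠ p} → Bool → ℕ :=
        Quot.lift (fun x => φ x.1) fun x y hxy => (hle x.1 y.1 x.2 hxy).symm
      exact (congrArg L u₀.1.2).trans (congrArg L v.1.2).symm
    -- Following `true` up from `p` gives `false` over `u₀` but `true` over `v`; since `φ` agrees at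
    -- both points, injectivity fails.
    have hu := (hφ p trivial).2 u₀.1.1.1 u₀.2 true
    have hv' := (hφ p trivial).2 v.1.1.1 v.2 true
    have hu' : u₀.1.1.1 ∈ S' := ⟨u₀.1.1.2, u₀.1.2, u₀.2, h0⟩
    have hv'' : v.1.1.1 ∉ S' := fun ⟨_, _, _, h⟩ => hv h
    simp only [hu', hv'', and_self, decide_true, decide_false, and_false, Bool.xor_false,
      Bool.xor_true, Bool.not_true] at hu hv'
    rw [hconst, ← hv'] at hu
    exact absurd ((hφ v.1.1.1 trivial).1 hu) (by simp)

theorem ForestLike.of_hasDoubleCoverCocones (P : Type w) [PartialOrder P] [Finite P]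
    (h : HasDoubleCoverCocones P) : ForestLike P := by
  obtain ⟨n, ⟨e⟩⟩ := Finite.exists_equiv_fin (PosetComponents P)
  refine ⟨n, fun k => PosetComponent P (e.symm k), inferInstance, fun k => ?_,
    ⟨(PosetComponent.sigmaIso e).symm⟩⟩
  have := PosetComponent.isConnected (e.symm k)
  refine TreeLike.of_hasDoubleCoverCocones _ (h.of_embedding (OrderEmbedding.subtype _) ?_)
  rintro _ y hxy ⟨⟨x, hi⟩, rfl⟩
  exact ⟨⟨y, (Quot.sound (show x ≤ y from hxy)).symm.trans hi⟩, rfl⟩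

/-! ### Amalgamation in elementary terms -/

section Amalgamation

variable {C : Type u} [Category.{v} C]

theorem HasAP.exists_comp_eq (hC : HasAP C) {X Y Z : C} (f : X ⟶ Y) (g : X ⟶ Z) :
    ∃ (W : C) (h : Y ⟶ W) (k : Z ⟶ W), f ≫ h = g ≫ k := by
  obtain ⟨c⟩ := hC (span f g)
  exact ⟨c.pt, c.ι.app WalkingSpan.left, c.ι.app WalkingSpan.right,
    (c.w WalkingSpan.Hom.fst).trans (c.w WalkingSpan.Hom.snd).symm⟩

theorem hasAP_of_exists (h : ∀ {X Y Z : C} (f : X ⟶ Y) (g : X ⟶ Z),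
    ∃ (W : C) (h : Y ⟶ W) (k : Z ⟶ W), f ≫ h = g ≫ k) : HasAP C := by
  intro F
  obtain ⟨W, a, b, hab⟩ := h (F.map WalkingSpan.Hom.fst) (F.map WalkingSpan.Hom.snd)
  exact ⟨(Cocone.precompose (diagramIsoSpan F).hom).obj (PushoutCocone.mk a b hab)⟩

theorem HasJEP.exists_hom (hC : HasJEP C) {n : ℕ} (X : Fin n → C) :
    ∃ W : C, ∀ k, Nonempty (X k ⟶ W) := by
  obtain ⟨c⟩ := hC n (Discrete.functor X)
  exact ⟨c.pt, fun k => ⟨c.ι.app ⟨k⟩⟩⟩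

theorem hasJEP_of_exists (h : ∀ (n : ℕ) (X : Fin n → C), ∃ W : C, ∀ k, Nonempty (X k ⟶ W)) :
    HasJEP C := by
  intro n F
  obtain ⟨W, hW⟩ := h n fun k => F.obj ⟨k⟩
  exact ⟨⟨W, Discrete.natTrans fun k => (hW k.as).some⟩⟩

/-- Finitely many morphisms with a common source can be amalgamated. -/
theorem HasAP.exists_wide (hC : HasAP C) {ι : Type*} [Finite ι] {X : C} {Y : ι → C}
    (f : ∀ k, X ⟶ Y k) : ∃ (W : C) (p : X ⟶ W) (g : ∀ k, Y k ⟶ W), ∀ k, f k ≫ g k = p := by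
  classical
  cases nonempty_fintype ι
  -- Recording the common composite `p` makes the empty family meaningful: there the identity of `X`
  -- serves.
  have key : ∀ s : Finset ι, ∃ (W : C) (p : X ⟶ W), ∀ k ∈ s, ∃ g : Y k ⟶ W, f k ≫ g = p := by
    intro s
    induction s using Finset.induction_on with
    | empty => exact ⟨X, 𝟙 X, by simp⟩
    | insert a s _ ih =>
      obtain ⟨W, p, hp⟩ := ih
      obtain ⟨W', a', b', hab⟩ := hC.exists_comp_eq p (f a)
      refine ⟨W', p ≫ a', fun k hk => ?_⟩
      rcases Finset.mem_insert.1 hk with rfl | hk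
      · exact ⟨b', hab.symm⟩
      · obtain ⟨g, hg⟩ := hp k hk
        exact ⟨g ≫ a', by rw [← Category.assoc, hg]⟩
  obtain ⟨W, p, hp⟩ := key Finset.univ
  choose g hg using fun k => hp k (Finset.mem_univ k)
  exact ⟨W, p, g, hg⟩

/-! ### Cocones over tree-like and forest-like posets -/

/-- A cocone over a diagram indexed by a poset can be given along an order isomorphism. -/
theorem nonempty_cocone_of_orderIso {P Q : Type w} [PartialOrder P] [PartialOrder Q] (e : P ≃o Q)
    (F : P ⥤ C) {W : C} (φ : ∀ a : Q, F.obj (e.symm a) ⟶ W)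
    (hφ : ∀ (a b : Q) (h : a ≤ b), F.map (homOfLE (e.symm.monotone h)) ≫ φ b = φ a) :
    Nonempty (Cocone F) := by
  refine ⟨⟨W, ⟨fun x => F.map (homOfLE (e.symm_apply_apply x).ge) ≫ φ (e x), fun x y f => ?_⟩⟩⟩
  have h := hφ (e x) (e y) (e.monotone (leOfHom f))
  simp only [Functor.const_obj_obj, Functor.const_obj_map, Category.comp_id]
  rw [← h, ← Category.assoc, ← Category.assoc, ← F.map_comp, ← F.map_comp]
  rfl

/-- Take cocones over the subtrees `K k`. Since `U k` is connected, all routes from the new point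
through `U k` to the apex of the `k`-th cocone agree, so each subtree contributes a single morphism
out of the new point. These finitely many morphisms are amalgamated. -/
theorem TreeLike.nonempty_cocone {P : Type w} [PartialOrder P] (hP : TreeLike P) (hC : HasAP C)
    (F : P ⥤ C) : Nonempty (Cocone F) := by
  induction hP with
  | @adjoin n K _ U hK hU P _ e ih =>
    have hin : ∀ k, Monotone fun x : K k => e.symm (⟨some ⟨k, x⟩⟩ : AdjoinPoint K U) :=
      fun k x y hxy => e.symm.monotone (show (⟨k, x⟩ : Σ k, K k) ≤ ⟨k, y⟩ from .fiber _ _ _ hxy)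
    have c := fun k => (ih k ((hin k).functor ⋙ F)).some
    have hpt : ∀ k (x : {x : K k // x ∈ U k}),
        e.symm (⟨none⟩ : AdjoinPoint K U) ≤ e.symm ⟨some ⟨k, x.1⟩⟩ :=
      fun k x => e.symm.monotone (show x.1 ∈ U k from x.2)
    let q : ∀ k, {x : K k // x ∈ U k} → (F.obj (e.symm ⟨none⟩) ⟶ (c k).pt) :=
      fun k x => F.map (homOfLE (hpt k x)) ≫ (c k).ι.app x.1
    have hq : ∀ k x y, q k x = q k y := fun k => by
      have := hU k
      refine constant_of_preserves_morphisms (q k) fun x y f => ?_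
      have hw := (c k).w (homOfLE (show x.1 ≤ y.1 from leOfHom f))
      refine (congrArg (F.map (homOfLE (hpt k x)) ≫ ·) hw.symm).trans ?_
      exact (Category.assoc _ _ _).symm.trans (congrArg (· ≫ _) (F.map_comp _ _).symm)
    have x₀ := fun k => (hU k).is_nonempty.some
    obtain ⟨W, p, g, hg⟩ := hC.exists_wide fun k => q k (x₀ k)
    refine nonempty_cocone_of_orderIso e F (W := W) (fun a => match a with
      | ⟨none⟩ => p
      | ⟨some ⟨k, x⟩⟩ => (c k).ι.app x ≫ g k) ?_
    rintro ⟨_ | x⟩ ⟨_ | ⟨k, y⟩⟩ h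
    · exact (congrArg (· ≫ p) (F.map_id _)).trans (Category.id_comp _)
    · change F.map _ ≫ (c k).ι.app y ≫ g k = p
      rw [← hg k, hq k (x₀ k) ⟨y, h⟩, ← Category.assoc]
      rfl
    · exact h.elim
    · obtain ⟨_, x, _, h'⟩ := h
      change F.map _ ≫ (c k).ι.app y ≫ g k = (c k).ι.app x ≫ g k
      rw [← (c k).w (homOfLE h')]
      exact (Category.assoc _ _ _).symm

theorem ForestLike.nonempty_cocone {P : Type w} [PartialOrder P] (hP : ForestLike P)
    (hC : HasAP C) (hC' : HasJEP C) (F : P ⥤ C) : Nonempty (Cocone F) := by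
  obtain ⟨n, K, _, hK, ⟨e⟩⟩ := hP
  have hin : ∀ k, Monotone fun x : K k => e.symm ⟨k, x⟩ :=
    fun k x y hxy => e.symm.monotone (.fiber _ _ _ hxy)
  have c := fun k => ((hK k).nonempty_cocone hC ((hin k).functor ⋙ F)).some
  obtain ⟨W, hW⟩ := hC'.exists_hom fun k => (c k).pt
  refine nonempty_cocone_of_orderIso e F (W := W) (fun a => (c a.1).ι.app a.2 ≫ (hW a.1).some) ?_
  rintro _ _ ⟨k, x, y, h⟩
  rw [← (c k).w (homOfLE h)]
  exact (Category.assoc _ _ _).symm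

/-! ### The monic quotient of a category with the amalgamation property -/

/-- Two morphisms are eventually equal if they have a common postcomposite. -/
def eventuallyEq (C : Type u) [Category.{v} C] : HomRel C :=
  fun _ Y f g => ∃ (Z : C) (h : Y ⟶ Z), f ≫ h = g ≫ h

/-- Amalgamation supplies transitivity, by merging two witnesses, and stability under
postcomposition, by moving a witness past the new morphism. -/
theorem HasAP.congruence_eventuallyEq (hC : HasAP C) : Congruence (eventuallyEq C) where
  equivalence := by
    refine ⟨fun f => ⟨_, 𝟙 _, rfl⟩, fun ⟨Z, h, e⟩ => ⟨Z, h, e.symm⟩, ?_⟩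
    rintro f g k ⟨Z, h, e⟩ ⟨Z', h', e'⟩
    obtain ⟨W, a, b, hab⟩ := hC.exists_comp_eq h h'
    refine ⟨W, h ≫ a, ?_⟩
    rw [← Category.assoc, e, Category.assoc, hab, ← Category.assoc, e', Category.assoc]
  comp_left := by
    rintro _ _ _ f g g' ⟨Z, h, e⟩
    exact ⟨Z, h, by rw [Category.assoc, e, Category.assoc]⟩
  comp_right := by
    rintro _ _ _ f f' g ⟨Z, h, e⟩
    obtain ⟨W, a, b, hab⟩ := hC.exists_comp_eq h g
    refine ⟨W, b, ?_⟩
    rw [Category.assoc, ← hab, ← Category.assoc, e, Category.assoc, hab, Category.assoc]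

/-- The quotient of `C` by eventual equality. -/
abbrev EventualQuotient (C : Type u) [Category.{v} C] := CategoryTheory.Quotient (eventuallyEq C)

/-- If `g ≫ f` and `h ≫ f` become equal after `k`, then `f ≫ k` itself witnesses that `g` and `h`
are eventually equal. -/
theorem HasAP.eventualQuotient_mono (hC : HasAP C) {X Y : EventualQuotient C} (f : X ⟶ Y) :
    Mono f := by
  have := hC.congruence_eventuallyEq
  obtain ⟨f, rfl⟩ := (CategoryTheory.Quotient.functor (eventuallyEq C)).map_surjective f
  refine ⟨fun {Z} g h e => ?_⟩
  obtain ⟨g, rfl⟩ := (CategoryTheory.Quotient.functor (eventuallyEq C)).map_surjective (X := Z.as) g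
  obtain ⟨h, rfl⟩ := (CategoryTheory.Quotient.functor (eventuallyEq C)).map_surjective (X := Z.as) h
  erw [← Functor.map_comp, ← Functor.map_comp, CategoryTheory.Quotient.functor_map_eq_iff] at e
  obtain ⟨W, k, e⟩ := e
  exact CategoryTheory.Quotient.sound _ ⟨W, f ≫ k, by rw [← Category.assoc, e, Category.assoc]⟩

theorem HasAP.eventualQuotient (hC : HasAP C) : HasAP (EventualQuotient C) := by
  refine hasAP_of_exists fun {X Y Z} f g => ?_
  obtain ⟨f, rfl⟩ := (CategoryTheory.Quotient.functor (eventuallyEq C)).map_surjective (X := X.as) (Y := Y.as) f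
  obtain ⟨g, rfl⟩ := (CategoryTheory.Quotient.functor (eventuallyEq C)).map_surjective (X := X.as) (Y := Z.as) g
  obtain ⟨W, h, k, e⟩ := hC.exists_comp_eq f g
  refine ⟨⟨W⟩, (CategoryTheory.Quotient.functor (eventuallyEq C)).map h,
    (CategoryTheory.Quotient.functor (eventuallyEq C)).map k, ?_⟩
  exact congrArg (CategoryTheory.Quotient.functor (eventuallyEq C)).map e

theorem HasJEP.eventualQuotient (hC : HasJEP C) : HasJEP (EventualQuotient C) := by
  refine hasJEP_of_exists fun n X => ?_
  obtain ⟨W, hW⟩ := hC.exists_hom fun k => (X k).as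
  exact ⟨⟨W⟩, fun k => ⟨(CategoryTheory.Quotient.functor (eventuallyEq C)).map (hW k).some⟩⟩

/-- Cocones over finite diagrams lift along the quotient by eventual equality. -/
theorem HasAP.nonempty_cocone_of_eventualQuotient (hC : HasAP C) {I : Type w} [Category.{w'} I]
    [Finite (Σ X Y : I, X ⟶ Y)] (F : I ⥤ C)
    (h : Nonempty (Cocone (F ⋙ CategoryTheory.Quotient.functor (eventuallyEq C)))) : Nonempty (Cocone F) := by
  have := hC.congruence_eventuallyEq
  obtain ⟨c⟩ := h
  choose φ hφ using fun X => (CategoryTheory.Quotient.functor (eventuallyEq C)).map_surjective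
    (X := F.obj X) (Y := c.pt.as) (c.ι.app X)
  have hev : ∀ a : Σ X Y : I, X ⟶ Y, eventuallyEq C (F.map a.2.2 ≫ φ a.2.1) (φ a.1) := by
    intro a
    refine (CategoryTheory.Quotient.functor_map_eq_iff (eventuallyEq C) _ _).1 ?_
    rw [Functor.map_comp, hφ, hφ]
    exact c.w a.2.2
  choose Z h e using hev
  -- Each naturality equation holds only after its own `h a`. As there are finitely many, one
  -- morphism `p` factoring through all the `h a` makes them hold at once.
  obtain ⟨W, p, g, hg⟩ := hC.exists_wide h
  refine ⟨⟨W, ⟨fun X => φ X ≫ p, fun X Y f => ?_⟩⟩⟩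
  have := e ⟨X, Y, f⟩
  simp only [Functor.const_obj_obj, Functor.const_obj_map, Category.comp_id]
  rw [← hg ⟨X, Y, f⟩, ← Category.assoc, ← Category.assoc, this, Category.assoc]

end Amalgamation

/-! ### The monic reflection -/

section MonicReflection

variable {I : Type w} [Category.{w'} I]

/-- The kernel of a functor into a monic category is a congruence with monic quotient, so it
contains the least one. -/
theorem monicRel.map_eq {D : Type u} [Category.{v} D] (hD : ∀ ⦃A B : D⦄ (h : A ⟶ B), Mono h)
    (G : I ⥤ D) {X Y : I} {f g : X ⟶ Y} (h : monicRel I f g) : G.map f = G.map g := by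
  refine h G.homRel inferInstance fun A B k => ?_
  obtain ⟨k, rfl⟩ := (CategoryTheory.Quotient.functor G.homRel).map_surjective (X := A.as) (Y := B.as) k
  refine ⟨fun {Z} a b e => ?_⟩
  obtain ⟨a, rfl⟩ := (CategoryTheory.Quotient.functor G.homRel).map_surjective (X := Z.as) (Y := A.as) a
  obtain ⟨b, rfl⟩ := (CategoryTheory.Quotient.functor G.homRel).map_surjective (X := Z.as) (Y := A.as) b
  erw [← Functor.map_comp, ← Functor.map_comp, CategoryTheory.Quotient.functor_map_eq_iff] at e
  have := hD (G.map k)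
  refine CategoryTheory.Quotient.sound _ ((cancel_mono (G.map k)).1 ?_)
  simpa using e

instance monicRel.congruence : Congruence (monicRel I) where
  equivalence := ⟨fun f _ hr _ => hr.equivalence.refl f,
    fun h r hr hm => hr.equivalence.symm (h r hr hm),
    fun h h' r hr hm => hr.equivalence.trans (h r hr hm) (h' r hr hm)⟩
  comp_left f _ _ h r hr hm := hr.comp_left f (h r hr hm)
  comp_right g h r hr hm := hr.comp_right g (h r hr hm)

/-- `monicRel` is the intersection of all congruences with monic quotient; cancellation holds modulo
each of them, hence modulo the intersection. -/
instance MonicReflection.mono {X Y : MonicReflection I} (f : X ⟶ Y) : Mono f := by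
  obtain ⟨f, rfl⟩ := (CategoryTheory.Quotient.functor (monicRel I)).map_surjective (X := X.as) (Y := Y.as) f
  refine ⟨fun {Z} g h e => ?_⟩
  obtain ⟨g, rfl⟩ := (CategoryTheory.Quotient.functor (monicRel I)).map_surjective (X := Z.as) (Y := X.as) g
  obtain ⟨h, rfl⟩ := (CategoryTheory.Quotient.functor (monicRel I)).map_surjective (X := Z.as) (Y := X.as) h
  erw [← Functor.map_comp, ← Functor.map_comp, CategoryTheory.Quotient.functor_map_eq_iff] at e
  refine CategoryTheory.Quotient.sound _ fun r hr hm => ?_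
  have := hm ((CategoryTheory.Quotient.functor r).map f)
  refine (CategoryTheory.Quotient.functor_map_eq_iff r _ _).1 ((cancel_mono ((CategoryTheory.Quotient.functor r).map f)).1 ?_)
  rw [← Functor.map_comp, ← Functor.map_comp]
  exact CategoryTheory.Quotient.sound _ (e r hr hm)

/-- A diagram in a category with the amalgamation property has a cocone if the diagrams indexed by
the skeleton of the monic reflection have cocones. -/
theorem HasAP.nonempty_cocone_of_thinSkeleton {C : Type u} [Category.{v} C] (hC : HasAP C)
    [Finite (Σ X Y : I, X ⟶ Y)] [Quiver.IsThin (MonicReflection I)]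
    (h : ∀ G : ThinSkeleton (MonicReflection I) ⥤ EventualQuotient C, Nonempty (Cocone G))
    (F : I ⥤ C) : Nonempty (Cocone F) := by
  apply hC.nonempty_cocone_of_eventualQuotient
  let G := F ⋙ CategoryTheory.Quotient.functor (eventuallyEq C)
  -- The diagram descends to the monic reflection because the target is monic. Thinness then makes
  -- the skeleton equivalent to that reflection, so cocones extend from it.
  let H : MonicReflection I ⥤ EventualQuotient C := CategoryTheory.Quotient.lift (monicRel I) G
    fun _ _ _ _ hfg => hfg.map_eq (fun _ _ f => hC.eventualQuotient_mono f) G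
  obtain ⟨c⟩ := h (ThinSkeleton.fromThinSkeleton _ ⋙ H)
  have e : CategoryTheory.Quotient.functor (monicRel I) ⋙ H = G := CategoryTheory.Quotient.lift_spec _ _ _
  change Nonempty (Cocone G)
  rw [← e]
  exact ⟨((Functor.Final.extendCocone (F := ThinSkeleton.fromThinSkeleton _)).obj c).whisker _⟩

end MonicReflection

/-! ### From forest-like and tree-like skeletons to cocones -/

theorem CoconesFromAPJEP.of_forestLike {I : Type w} [Category.{w'} I] [Finite (Σ X Y : I, X ⟶ Y)]
    [Quiver.IsThin (MonicReflection I)] (h : ForestLike (ThinSkeleton (MonicReflection I))) :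
    CoconesFromAPJEP.{w, w', u, v} I := fun _ _ hC hC' F =>
  hC.nonempty_cocone_of_thinSkeleton
    (fun G => h.nonempty_cocone hC.eventualQuotient hC'.eventualQuotient G) F

theorem CoconesFromAP.of_treeLike {I : Type w} [Category.{w'} I] [Finite (Σ X Y : I, X ⟶ Y)]
    [Quiver.IsThin (MonicReflection I)] (h : TreeLike (ThinSkeleton (MonicReflection I))) :
    CoconesFromAP.{w, w', u, v} I := fun _ _ hC F =>
  hC.nonempty_cocone_of_thinSkeleton (fun G => h.nonempty_cocone hC.eventualQuotient G) F

/-! ### Diagrams of sets and injections -/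

/-- A diagram of sets and injections of shape `I`. -/
structure InjDiagram (I : Type w) [Category.{w'} I] where
  obj : I → Type t
  map : ∀ {X Y : I}, (X ⟶ Y) → obj X → obj Y
  map_comp : ∀ {X Y Z : I} (f : X ⟶ Y) (g : Y ⟶ Z) (a : obj X), map (f ≫ g) a = map g (map f a)
  injective : ∀ {X Y : I} (f : X ⟶ Y), Function.Injective (map f)

namespace InjDiagram

variable {I : Type w} [Category.{w'} I]

/-- The identity law need not be a field: an idempotent injection is the identity. -/
theorem map_id (F : InjDiagram.{w, w', t} I) (X : I) (a : F.obj X) : F.map (𝟙 X) a = a :=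
  F.injective (𝟙 X) (by rw [← F.map_comp, Category.comp_id])

/-- The diagram has a cocone of injections into a countable set. -/
def HasCocone (F : InjDiagram.{w, w', t} I) : Prop :=
  ∃ φ : ∀ X, F.obj X → ℕ, (∀ X, Function.Injective (φ X)) ∧
    ∀ {X Y : I} (f : X ⟶ Y) (a : F.obj X), φ Y (F.map f a) = φ X a

end InjDiagram

/-- Every `I`-shaped diagram of injections between sets with at most `N` elements has a cocone of
injections. -/
def HasBoundedCocones (N : ℕ) (I : Type w) [Category.{w'} I] : Prop :=
  ∀ F : InjDiagram.{w, w', 0} I, (∀ X, Nonempty (F.obj X ↪ Fin N)) → F.HasCocone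

section

variable {I : Type w} [Category.{w'} I]

/-- Replacing each set by its image in `Fin N` removes the restriction of the test diagrams to the
lowest universe. -/
theorem HasBoundedCocones.hasCocone {N : ℕ} (h : HasBoundedCocones N I)
    (F : InjDiagram.{w, w', t} I) (hF : ∀ X, Nonempty (F.obj X ↪ Fin N)) : F.HasCocone := by
  have e : ∀ X, F.obj X ↪ Fin N := fun X => (hF X).some
  let ε : ∀ X, F.obj X ≃ Set.range (e X) := fun X => Equiv.ofInjective _ (e X).injective
  let G : InjDiagram.{w, w', 0} I :=
    { obj := fun X => Set.range (e X)
      map := fun {X Y} f a => ε Y (F.map f ((ε X).symm a))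
      map_comp := fun f g a => by simp [F.map_comp]
      injective := fun {X Y} f =>
        (ε Y).injective.comp ((F.injective f).comp (ε X).symm.injective) }
  obtain ⟨φ, hφ, hc⟩ := h G fun X => ⟨Function.Embedding.subtype _⟩
  refine ⟨fun X a => φ X (ε X a), fun X => (hφ X).comp (ε X).injective, fun {X Y} f a => ?_⟩
  have := hc f (ε X a)
  simpa [G] using this

/-! ### Formal expressions as partial injections -/

/-- The partial injection that a formal expression denotes in a diagram of injections. -/
def InvTerm.Denotes (F : InjDiagram.{w, w', t} I) :
    ∀ {X Y : I}, InvTerm I X Y → F.obj X → F.obj Y → Prop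
  | _, _, .of i => fun a b => F.map i a = b
  | _, _, .id _ => fun a b => a = b
  | _, _, .comp f g => fun a c => ∃ b, Denotes F f a b ∧ Denotes F g b c
  | _, _, .inv f => fun a b => Denotes F f b a

theorem InvTerm.Denotes.unique {F : InjDiagram.{w, w', t} I} {X Y : I} (s : InvTerm I X Y) :
    (∀ {a b b'}, s.Denotes F a b → s.Denotes F a b' → b = b') ∧
      ∀ {a a' b}, s.Denotes F a b → s.Denotes F a' b → a = a' := by
  induction s with
  | of i => exact ⟨fun h h' => h.symm.trans h', fun h h' => F.injective i (h.trans h'.symm)⟩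
  | id X => exact ⟨fun h h' => h.symm.trans h', fun h h' => h.trans h'.symm⟩
  | comp f g ihf ihg =>
    refine ⟨?_, ?_⟩
    · rintro a c c' ⟨b, h1, h2⟩ ⟨b', h1', h2'⟩
      obtain rfl := ihf.1 h1 h1'
      exact ihg.1 h2 h2'
    · rintro a a' c ⟨b, h1, h2⟩ ⟨b', h1', h2'⟩
      obtain rfl := ihg.2 h2 h2'
      exact ihf.2 h1 h1'
  | inv f ih => exact ⟨fun h h' => ih.2 h h', fun h h' => ih.1 h h'⟩

/-- Partial injections satisfy the laws of inverse categories, and a total injection followed by its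
inverse is the identity. Hence a diagram of injections interprets the morphisms of `LeftFundInv I`.
-/
theorem InvTerm.Rel.denotes_iff (F : InjDiagram.{w, w', t} I) {X Y : I} {s s' : InvTerm I X Y}
    (h : InvTerm.Rel s s') : ∀ a b, s.Denotes F a b ↔ s'.Denotes F a b := by
  induction h with
  | refl f => exact fun _ _ => Iff.rfl
  | symm _ ih => exact fun a b => (ih a b).symm
  | trans _ _ ih ih' => exact fun a b => (ih a b).trans (ih' a b)
  | comp_congr _ _ ih ih' =>
    exact fun a c => exists_congr fun b => and_congr (ih a b) (ih' b c)
  | inv_congr _ ih => exact fun a b => ih b a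
  | id_comp f => exact fun a b => ⟨fun ⟨_, e, h⟩ => e ▸ h, fun h => ⟨a, rfl, h⟩⟩
  | comp_id f => exact fun a b => ⟨fun ⟨_, h, e⟩ => e ▸ h, fun h => ⟨b, h, rfl⟩⟩
  | assoc f g h =>
    exact fun a b => ⟨fun ⟨c, ⟨d, h1, h2⟩, h3⟩ => ⟨d, h1, c, h2, h3⟩,
      fun ⟨d, h1, c, h2, h3⟩ => ⟨c, ⟨d, h1, h2⟩, h3⟩⟩
  | inv_inv f => exact fun _ _ => Iff.rfl
  | inv_comp f g => exact fun a b => exists_congr fun c => and_comm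
  | regular f =>
    refine fun a b => ⟨?_, fun h => ⟨b, h, a, h, h⟩⟩
    rintro ⟨c, h1, d, h2, h3⟩
    obtain rfl := (InvTerm.Denotes.unique f).2 h1 h2
    exact h3
  | idem_comm f g =>
    have key : ∀ {X Y Z : I} (f : InvTerm I X Y) (g : InvTerm I X Z) (a b : F.obj X),
        ((f.comp f.inv).comp (g.comp g.inv)).Denotes F a b →
          ((g.comp g.inv).comp (f.comp f.inv)).Denotes F a b := by
      rintro X Y Z f g a b ⟨c, ⟨d, h1, h2⟩, ⟨e, h3, h4⟩⟩
      obtain rfl := (InvTerm.Denotes.unique f).2 h1 h2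
      obtain rfl := (InvTerm.Denotes.unique g).2 h3 h4
      exact ⟨a, ⟨e, h3, h3⟩, ⟨d, h1, h1⟩⟩
    exact fun a b => ⟨key f g a b, key g f a b⟩
  | of_id X => exact fun a b => iff_of_eq (congrArg (· = b) (F.map_id X a))
  | of_comp i j =>
    intro a b
    refine (iff_of_eq (congrArg (· = b) (F.map_comp i j a))).trans ?_
    exact ⟨fun h => ⟨_, rfl, h⟩, fun ⟨_, e, h⟩ => by rw [← h, ← e]⟩
  | of_mono i =>
    exact fun a b => ⟨fun ⟨_, e, h⟩ => F.injective i (e.trans h.symm),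
      fun h => ⟨F.map i a, rfl, congrArg (F.map i) (Eq.symm h)⟩⟩

/-- Over an upward-simply-connected category, diagrams of injections have cocones of injections. -/
theorem UpwardSimplyConnected.hasCocone (h : UpwardSimplyConnected I)
    (F : InjDiagram.{w, w', t} I) [Countable (Σ X, F.obj X)] : F.HasCocone := by
  let S : Setoid (Σ X, F.obj X) :=
    { r := fun a b => ∃ s : InvTerm I a.1 b.1, s.Denotes F a.2 b.2
      iseqv := ⟨fun a => ⟨.id _, rfl⟩, fun ⟨s, hs⟩ => ⟨.inv s, hs⟩,
        fun ⟨s, hs⟩ ⟨s', hs'⟩ => ⟨.comp s s', _, hs, hs'⟩⟩ }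
  obtain ⟨c, hc⟩ := Countable.exists_injective_nat (_root_.Quotient S)
  refine ⟨fun X a => c (Quotient.mk S ⟨X, a⟩), fun X a b hab => ?_, fun {X Y} f a => ?_⟩
  · obtain ⟨s, hs⟩ : ∃ s : InvTerm I X X, s.Denotes F a b := Quotient.exact (hc hab)
    -- An idempotent partial injection fixes every point of its domain: `s` sends `a` to `b`, so
    -- does `s` applied twice, hence `s` fixes `b`, and injectivity gives `a = b`.
    have hr : InvTerm.Rel (s.comp s) s := Quotient.exact (h ⟨X⟩ (Quotient.mk _ s))
    obtain ⟨d, h1, h2⟩ := (hr.denotes_iff F a b).2 hs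
    obtain rfl := (InvTerm.Denotes.unique s).1 h1 hs
    exact (InvTerm.Denotes.unique s).2 hs h2
  · exact congrArg c (Quotient.sound (s := S)
      (show ∃ s : InvTerm I Y X, s.Denotes F (F.map f a) a from ⟨.inv (.of f), rfl⟩))

theorem UpwardSimplyConnected.hasBoundedCocones [Countable I] (h : UpwardSimplyConnected I)
    (N : ℕ) : HasBoundedCocones N I := by
  intro F hF
  have : ∀ X, Countable (F.obj X) := fun X => (hF X).some.injective.countable
  exact h.hasCocone F

/-! ### The monic reflection of a category over which diagrams of injections have cocones -/

/-- The representable diagram `Hom(A, -)` of the monic reflection consists of injections. A cocone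
sends every `a : A ⟶ B` to the value at `𝟙 A`, so parallel morphisms coincide. -/
theorem HasBoundedCocones.isThin {N : ℕ} (h : HasBoundedCocones N I)
    (e : (Σ X Y : I, X ⟶ Y) ↪ Fin N) : Quiver.IsThin (MonicReflection I) := by
  intro A B
  obtain ⟨φ, hφ, hc⟩ := h.hasCocone
    { obj := fun Y => A ⟶ (Quotient.functor (monicRel I)).obj Y
      map := fun f a => a ≫ (Quotient.functor (monicRel I)).map f
      map_comp := fun f g a => by rw [Functor.map_comp, Category.assoc]
      injective := fun f a b hab => (cancel_mono _).1 hab } fun Y => by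
    have hs := (Quotient.functor (monicRel I)).map_surjective (X := A.as) (Y := Y)
    refine ⟨⟨fun a => e ⟨A.as, Y, Function.surjInv hs a⟩, fun a b hab => ?_⟩⟩
    have := e.injective hab
    simp only [Sigma.mk.injEq, heq_eq_eq, true_and] at this
    exact Function.injective_surjInv hs this
  refine ⟨fun a b => ?_⟩
  obtain ⟨a, rfl⟩ := (Quotient.functor (monicRel I)).map_surjective (X := A.as) (Y := B.as) a
  obtain ⟨b, rfl⟩ := (Quotient.functor (monicRel I)).map_surjective (X := A.as) (Y := B.as) b
  have key := (hc a (𝟙 A)).trans (hc b (𝟙 A)).symm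
  simpa using hφ B.as key

/-- A double cover pulls back along `q` to a diagram with fibres of size two over `A` and empty
fibres elsewhere; `2 ≤ N` makes it a test diagram. -/
theorem HasBoundedCocones.hasDoubleCoverCocones {N : ℕ} (h : HasBoundedCocones N I) (hN : 2 ≤ N)
    {P : Type u} [PartialOrder P] (q : I → P) (hq : Function.Surjective q)
    (hle : ∀ X Y, q X ≤ q Y ↔ Nonempty (X ⟶ Y)) : HasDoubleCoverCocones P := by
  classical
  intro A hA σ hσ
  obtain ⟨φ, hφ, hc⟩ := h
    { obj := fun X => {_b : Bool // q X ∈ A}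
      map := fun {X Y} f a => ⟨xor a.1 (σ (q X) (q Y)), hA ((hle X Y).2 ⟨f⟩) a.2⟩
      map_comp := fun {X Y Z} f g a => Subtype.ext <| by
        simp [hσ _ a.2 _ _ ((hle X Y).2 ⟨f⟩) ((hle Y Z).2 ⟨g⟩)]
      injective := fun {X Y} f a b hab => Subtype.ext <| by simpa using hab } fun X =>
    ⟨(Function.Embedding.subtype _).trans
      ((finTwoEquiv.symm.toEmbedding).trans (Fin.castLEEmb hN))⟩
  let r := Function.surjInv hq
  have hr : ∀ x, q (r x) = x := Function.surjInv_eq hq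
  refine ⟨fun x b => if hx : q (r x) ∈ A then φ (r x) ⟨b, hx⟩ else 0, fun x hx => ⟨?_, ?_⟩⟩
  · intro b b' hb
    simp only [hr, hx, dif_pos] at hb
    simpa using hφ _ hb
  · intro y hxy b
    have hy : y ∈ A := hA hxy hx
    obtain ⟨f⟩ := (hle (r x) (r y)).1 (by rwa [hr, hr])
    simp only [hr, hx, hy, dif_pos]
    have := hc f ⟨b, (hr x).symm ▸ hx⟩
    simpa only [hr] using this

/-- The map from a category to the skeleton of its monic reflection. -/
def toMonicSkeleton (I : Type w) [Category.{w'} I] : I ⥤ ThinSkeleton (MonicReflection I) :=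
  Quotient.functor (monicRel I) ⋙ toThinSkeleton _

theorem toMonicSkeleton_surjective :
    Function.Surjective (toMonicSkeleton I).obj := by
  intro x
  obtain ⟨⟨X⟩, rfl⟩ := Quotient.exists_rep x
  exact ⟨X, rfl⟩

theorem toMonicSkeleton_le_iff (X Y : I) :
    (toMonicSkeleton I).obj X ≤ (toMonicSkeleton I).obj Y ↔ Nonempty (X ⟶ Y) := by
  constructor
  · rintro ⟨f⟩
    obtain ⟨f, -⟩ := (Quotient.functor (monicRel I)).map_surjective (X := X) (Y := Y) f
    exact ⟨f⟩
  · rintro ⟨f⟩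
    exact leOfHom ((toMonicSkeleton I).map f)

theorem isConnected_monicSkeleton [CategoryTheory.IsConnected I]
    [Quiver.IsThin (MonicReflection I)] :
    CategoryTheory.IsConnected (ThinSkeleton (MonicReflection I)) := by
  obtain ⟨X⟩ := (inferInstance : Nonempty I)
  refine IsConnected.of_induct (j₀ := (toMonicSkeleton I).obj X) fun p h0 hp j => ?_
  obtain ⟨Y, rfl⟩ := toMonicSkeleton_surjective j
  exact induct_on_objects {Y | (toMonicSkeleton I).obj Y ∈ p} h0
    (fun f => hp ((toMonicSkeleton I).map f)) Y

end

/-! ### Countability of formal expressions -/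

section Countability

variable {I : Type w} [Category.{w'} I]

/-- The code of a formal expression, given codes of the morphisms. -/
def InvTerm.code (c : (Σ X Y : I, X ⟶ Y) → ℕ) : ∀ {X Y : I}, InvTerm I X Y → ℕ
  | _, _, .of i => 4 * c ⟨_, _, i⟩
  | _, _, .id X => 4 * c ⟨X, X, 𝟙 X⟩ + 1
  | _, _, .comp f g => 4 * Nat.pair (code c f) (code c g) + 2
  | _, _, .inv f => 4 * code c f + 3

theorem InvTerm.code_injective {c : (Σ X Y : I, X ⟶ Y) → ℕ} (hc : Function.Injective c)
    {X Y : I} (s : InvTerm I X Y) {X' Y' : I} (s' : InvTerm I X' Y') (h : s.code c = s'.code c) :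
    (⟨X, Y, s⟩ : Σ X Y : I, InvTerm I X Y) = ⟨X', Y', s'⟩ := by
  induction s generalizing X' Y' with
  | of i =>
    cases s' <;> simp only [code] at h <;> try omega
    have := hc (a₁ := ⟨_, _, _⟩) (a₂ := ⟨_, _, _⟩) (Nat.eq_of_mul_eq_mul_left four_pos h)
    cases this
    rfl
  | id X =>
    cases s' <;> simp only [code] at h <;> try omega
    have := hc (a₁ := ⟨_, _, _⟩) (a₂ := ⟨_, _, _⟩)
      (Nat.eq_of_mul_eq_mul_left four_pos (Nat.add_right_cancel h))
    cases congrArg Sigma.fst this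
    rfl
  | comp f g ihf ihg =>
    cases s' <;> simp only [code] at h <;> try omega
    have := Nat.pair_eq_pair.1 (Nat.eq_of_mul_eq_mul_left four_pos (Nat.add_right_cancel h))
    cases ihf _ this.1
    cases ihg _ this.2
    rfl
  | inv f ih =>
    cases s' <;> simp only [code] at h <;> try omega
    cases ih _ (Nat.eq_of_mul_eq_mul_left four_pos (Nat.add_right_cancel h))
    rfl

theorem InvTerm.countable [Countable (Σ X Y : I, X ⟶ Y)] (X Y : I) :
    Countable (InvTerm I X Y) := by
  obtain ⟨c, hc⟩ := Countable.exists_injective_nat (Σ X Y : I, X ⟶ Y)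
  refine Function.Injective.countable (f := fun s : InvTerm I X Y => s.code c) fun s s' h => ?_
  have := InvTerm.code_injective hc s s' h
  simpa using this

end Countability

/-! ### The category of self-injections of a countable set -/

/-- The object of a category with one object, whose morphisms are the injections `ℕ → ℕ`. -/
def InjNat : Type u := PUnit.{u + 1}

instance InjNat.category : Category.{v} InjNat.{u} where
  Hom _ _ := ULift.{v} (ℕ ↪ ℕ)
  id _ := ⟨Function.Embedding.refl ℕ⟩
  comp f g := ⟨f.down.trans g.down⟩

/-- Pairs of injections can be amalgamated. -/
theorem exists_embedding_comp_eq (f g : ℕ ↪ ℕ) :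
    ∃ h k : ℕ ↪ ℕ, f.trans h = g.trans k := by
  classical
  -- The pushout of sets is placed inside `ℕ`: the target of `f` occupies the even numbers, and the
  -- points outside the range of `g` the odd ones.
  let k : ℕ → ℕ := fun z => if z ∈ Set.range g then 2 * f (Function.invFun g z) else 2 * z + 1
  have hk : ∀ x, k (g x) = 2 * f x := fun x => by
    simp [k, Function.leftInverse_invFun g.injective x]
  have hk' : ∀ z, z ∉ Set.range g → k z = 2 * z + 1 := fun z hz => if_neg hz
  refine ⟨⟨fun y => 2 * y, fun a b h => by simpa using h⟩, ⟨k, fun a b h => ?_⟩, ?_⟩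
  · by_cases ha : a ∈ Set.range g <;> by_cases hb : b ∈ Set.range g
    · obtain ⟨x, rfl⟩ := ha
      obtain ⟨y, rfl⟩ := hb
      rw [hk, hk] at h
      rw [f.injective (show f x = f y by omega)]
    · obtain ⟨x, rfl⟩ := ha
      rw [hk, hk' b hb] at h
      omega
    · obtain ⟨y, rfl⟩ := hb
      rw [hk, hk' a ha] at h
      omega
    · rw [hk' a ha, hk' b hb] at h
      omega
  · ext x
    exact (hk x).symm

theorem InjNat.hasAP : HasAP InjNat.{u} := by
  refine hasAP_of_exists fun {X Y Z} f g => ?_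
  obtain ⟨h, k, e⟩ := exists_embedding_comp_eq f.down g.down
  exact ⟨X, ⟨h⟩, ⟨k⟩, congrArg ULift.up e⟩

theorem InjNat.hasJEP : HasJEP InjNat.{u} :=
  hasJEP_of_exists fun _ _ => ⟨PUnit.unit, fun _ => ⟨⟨Function.Embedding.refl ℕ⟩⟩⟩

/-- A cocone on `X ↦ Hom(A, X)` in `LeftFundInv I` is injective at each object and unchanged by
every expression on its domain. Comparing `f` with `f ≫ f⁻¹` gives `f = f ≫ f⁻¹`, which is
idempotent. -/
theorem UpwardSimplyConnected.of_coconesFromAPJEP {I : Type w} [Category.{w'} I]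
    [Countable (Σ X Y : I, X ⟶ Y)] (h : CoconesFromAPJEP.{w, w', u, v} I) :
    UpwardSimplyConnected I := by
  rintro ⟨A⟩ f
  let L : I → Type max w w' := fun X => (LeftFundInv.η I).obj A ⟶ (LeftFundInv.η I).obj X
  have hL : ∀ X, Countable (L X) := fun X => by
    have := InvTerm.countable A X
    exact inferInstanceAs (Countable (_root_.Quotient (InvTerm.setoid A X)))
  -- Adding a copy of `ℕ`, on which all maps act as the identity, makes every set countably
  -- infinite, so the diagram lives in the one-object category `InjNat`.
  have e : ∀ X, L X ⊕ ℕ ≃ ℕ := fun X => (nonempty_equiv_of_countable (α := L X ⊕ ℕ) (β := ℕ)).some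
  -- postcomposition with a morphism of `I`
  let m : ∀ {X Y : I}, (X ⟶ Y) → L X → L Y := fun i p => p ≫ (LeftFundInv.η I).map i
  let s : ∀ {X Y : I} (i : X ⟶ Y), (LeftFundInv.η I).obj Y ⟶ (LeftFundInv.η I).obj X :=
    fun {X Y} i => Quotient.mk (InvTerm.setoid Y X) (InvTerm.of i).inv
  have hs : ∀ {X Y : I} (i : X ⟶ Y), (LeftFundInv.η I).map i ≫ s i = 𝟙 _ :=
    fun i => Quotient.sound (InvTerm.Rel.of_mono i)
  have hm : ∀ {X Y : I} (i : X ⟶ Y), Function.Injective (m i) := fun i p q hpq => by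
    have := congrArg (· ≫ s i) hpq
    simpa [m, hs] using this
  let F : I ⥤ InjNat.{u} :=
    { obj := fun _ => PUnit.unit
      map := fun {X Y} i => ⟨⟨fun n => e Y (Sum.map (m i) id ((e X).symm n)),
        (e Y).injective.comp
          (((hm i).sumMap Function.injective_id).comp (e X).symm.injective)⟩⟩
      map_id := fun X => by
        refine congrArg ULift.up (Function.Embedding.ext fun n => ?_)
        have : m (𝟙 X) = id := by
          funext p
          simp [m]
        change e X (Sum.map (m (𝟙 X)) id ((e X).symm n)) = n
        simp [this]
      map_comp := fun {X Y Z} i j => by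
        refine congrArg ULift.up (Function.Embedding.ext fun n => ?_)
        have : m (i ≫ j) = m j ∘ m i := by
          funext p
          simp [m]
        change e Z (Sum.map (m (i ≫ j)) id ((e X).symm n)) =
          e Z (Sum.map (m j) id ((e Y).symm (e Y (Sum.map (m i) id ((e X).symm n)))))
        simp [this] }
  obtain ⟨c⟩ := h InjNat InjNat.hasAP InjNat.hasJEP F
  let φ : ∀ X, L X → ℕ := fun X p => (c.ι.app X).down (e X (Sum.inl p))
  have hφ : ∀ X, Function.Injective (φ X) := fun X =>
    (c.ι.app X).down.injective.comp ((e X).injective.comp Sum.inl_injective)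
  have hc : ∀ {X Y : I} (i : X ⟶ Y) (p : L X), φ Y (m i p) = φ X p := fun {X Y} i p => by
    have := DFunLike.congr_fun (congrArg ULift.down (c.w i)) (e X (Sum.inl p))
    change (c.ι.app Y).down (e Y (Sum.map (m i) id ((e X).symm (e X (Sum.inl p))))) =
      (c.ι.app X).down (e X (Sum.inl p)) at this
    simpa using this
  let cl : ∀ {X Y : I}, InvTerm I X Y → ((LeftFundInv.η I).obj X ⟶ (LeftFundInv.η I).obj Y) :=
    fun {X Y} t => Quotient.mk (InvTerm.setoid X Y) t
  have reg : ∀ {X Y : I} (t : InvTerm I X Y), cl t ≫ cl t.inv ≫ cl t = cl t :=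
    fun t => Quotient.sound (InvTerm.Rel.regular t)
  have reg' : ∀ {X Y : I} (t : InvTerm I X Y), cl t.inv ≫ cl t ≫ cl t.inv = cl t.inv :=
    fun t => Quotient.sound (.trans (.comp_congr (.refl _) (.comp_congr (.symm (.inv_inv t))
      (.refl _))) (InvTerm.Rel.regular t.inv))
  have invc : ∀ {X Y Z : I} (t : InvTerm I X Y) (t' : InvTerm I Y Z),
      cl (t.comp t').inv = cl t'.inv ≫ cl t.inv :=
    fun t t' => Quotient.sound (InvTerm.Rel.inv_comp t t')
  have clc : ∀ {X Y Z : I} (t : InvTerm I X Y) (t' : InvTerm I Y Z),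
      cl (t.comp t') = cl t ≫ cl t' := fun t t' => rfl
  have invinv : ∀ {X Y : I} (t : InvTerm I X Y), cl t.inv.inv = cl t :=
    fun t => Quotient.sound (InvTerm.Rel.inv_inv t)
  have comm : ∀ {X Y Z : I} (t : InvTerm I X Y) (t' : InvTerm I X Z),
      (cl t ≫ cl t.inv) ≫ (cl t' ≫ cl t'.inv) = (cl t' ≫ cl t'.inv) ≫ (cl t ≫ cl t.inv) :=
    fun t t' => Quotient.sound (InvTerm.Rel.idem_comm t t')
  -- the cocone is constant along every expression, where it is defined
  have key : ∀ {X Y : I} (t : InvTerm I X Y) (p : L X), (p ≫ cl t) ≫ cl t.inv = p →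
      φ Y (p ≫ cl t) = φ X p := by
    intro X Y t
    induction t with
    | of i => exact fun p _ => hc i p
    | id X => exact fun p _ => congrArg (φ X) (Category.comp_id p)
    | @comp X Y Z t t' iht iht' =>
      intro p hp
      rw [clc, invc] at hp
      have h1 : (p ≫ cl t) ≫ cl t.inv = p := by
        rw [← hp]
        simp only [Category.assoc]
        rw [reg' t]
      -- The idempotents of `t'` and of `t.inv` on the middle object commute; this puts `p ≫ cl t`
      -- in the domain of `t'`.
      have h2 : ((p ≫ cl t) ≫ cl t') ≫ cl t'.inv = p ≫ cl t := by
        have h3 : (p ≫ cl t) ≫ (cl t' ≫ cl t'.inv) ≫ (cl t.inv ≫ cl t) = p ≫ cl t := by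
          have := congrArg (· ≫ cl t) hp
          simpa only [Category.assoc] using this
        have c1 := comm t' t.inv
        rw [invinv] at c1
        rw [c1] at h3
        simp only [Category.assoc] at h3 ⊢
        have h4 := congrArg (p ≫ ·) (reg t)
        have h5 : p ≫ cl t ≫ cl t.inv ≫ cl t ≫ cl t' ≫ cl t'.inv =
            (p ≫ cl t ≫ cl t.inv ≫ cl t) ≫ cl t' ≫ cl t'.inv := by simp only [Category.assoc]
        rw [h5, reg t] at h3
        simpa only [Category.assoc] using h3
      rw [clc, ← Category.assoc, iht' _ h2, iht _ h1]
    | @inv X Y t ih =>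
      intro p hp
      rw [invinv] at hp
      have := ih (p ≫ cl t.inv) (by rw [hp])
      rw [hp] at this
      exact this.symm
  obtain ⟨t, rfl⟩ : ∃ t : InvTerm I A A, cl t = f := Quotient.exists_rep f
  have h2 : φ A (cl t ≫ cl t.inv) = φ A (cl t) := key t.inv (cl t) (by rw [invinv, Category.assoc, reg t])
  have h3 : cl t = cl t ≫ cl t.inv := hφ A h2.symm
  calc cl t ≫ cl t = (cl t ≫ cl t.inv) ≫ cl t := by rw [← h3]
    _ = cl t := by rw [Category.assoc, reg t]

/-! ### Categories over which all diagrams in categories with the AP have cocones -/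

/-- The discrete category on a type, with morphisms in an arbitrary universe. -/
structure DiscretePoints (α : Type u) : Type u where
  as : α

instance DiscretePoints.category (α : Type u) : Category.{v} (DiscretePoints α) where
  Hom a b := ULift.{v} (PLift (a.as = b.as))
  id a := ⟨⟨rfl⟩⟩
  comp f g := ⟨⟨f.down.down.trans g.down.down⟩⟩

theorem DiscretePoints.hasAP (α : Type u) : HasAP (DiscretePoints.{u} α) :=
  hasAP_of_exists fun {X _ _} f g =>
    ⟨X, ⟨⟨f.down.down.symm⟩⟩, ⟨⟨g.down.down.symm⟩⟩, rfl⟩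

/-- Discrete categories have the AP. The empty one excludes empty `I`; the two-point one receives
the indicator of any set of objects closed in both directions, and a cocone makes this indicator
constant. -/
theorem CoconesFromAP.isConnected {I : Type w} [Category.{w'} I]
    (h : CoconesFromAP.{w, w', u, v} I) : CategoryTheory.IsConnected I := by
  classical
  have hne : Nonempty I := by
    by_contra hI
    obtain ⟨c⟩ := h (DiscretePoints PEmpty.{u + 1}) (DiscretePoints.hasAP _)
      { obj := fun X => (hI ⟨X⟩).elim
        map := fun {X} => (hI ⟨X⟩).elim
        map_id := fun X => (hI ⟨X⟩).elim
        map_comp := fun {X} => (hI ⟨X⟩).elim }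
    exact c.pt.as.elim
  obtain ⟨X⟩ := hne
  have : Nonempty I := ⟨X⟩
  refine IsConnected.of_induct (j₀ := X) fun p h0 hp j => ?_
  obtain ⟨c⟩ := h (DiscretePoints (ULift.{u} Bool)) (DiscretePoints.hasAP _)
    { obj := fun X => ⟨⟨decide (X ∈ p)⟩⟩
      map := fun {X Y} f => ⟨⟨by simp [hp f]⟩⟩ }
  have e := (c.ι.app X).down.down.trans (c.ι.app j).down.down.symm
  have e' : decide (X ∈ p) = decide (j ∈ p) := congrArg ULift.down e
  simpa [h0] using e'

/-! ### The equivalences for a finite category -/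

section Equivalences

variable {I : Type w} [Category.{w'} I]

theorem HasBoundedCocones.hasDoubleCoverCocones_monicSkeleton {N : ℕ} (h : HasBoundedCocones N I)
    (hN : 2 ≤ N) [Quiver.IsThin (MonicReflection I)] :
    HasDoubleCoverCocones (ThinSkeleton (MonicReflection I)) :=
  h.hasDoubleCoverCocones hN _ toMonicSkeleton_surjective toMonicSkeleton_le_iff

theorem finite_monicSkeleton [Finite I] : Finite (ThinSkeleton (MonicReflection I)) :=
  Finite.of_surjective _ (toMonicSkeleton_surjective (I := I))

theorem HasBoundedCocones.exists_forestLike [Finite I] {N : ℕ} (h : HasBoundedCocones N I) (hN : 2 ≤ N)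
    (e : (Σ X Y : I, X ⟶ Y) ↪ Fin N) : ∃ _ : Quiver.IsThin (MonicReflection I),
      ForestLike (ThinSkeleton (MonicReflection I)) := by
  have ht := h.isThin e
  have := finite_monicSkeleton (I := I)
  exact ⟨ht, .of_hasDoubleCoverCocones _ (h.hasDoubleCoverCocones_monicSkeleton hN)⟩

theorem UpwardSimplyConnected.tfae [Finite I] [Finite (Σ X Y : I, X ⟶ Y)] {N : ℕ}
    (hN : 2 ≤ N) (e : (Σ X Y : I, X ⟶ Y) ↪ Fin N) :
    List.TFAE [UpwardSimplyConnected I, HasBoundedCocones N I,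
      ∃ _ : Quiver.IsThin (MonicReflection I), ForestLike (ThinSkeleton (MonicReflection I)),
      CoconesFromAPJEP.{w, w', u, v} I] := by
  tfae_have 1 → 2 := fun h => h.hasBoundedCocones N
  tfae_have 2 → 3 := fun h => h.exists_forestLike hN e
  tfae_have 3 → 4 := fun ⟨_, h⟩ => .of_forestLike h
  tfae_have 4 → 1 := fun h => .of_coconesFromAPJEP h
  tfae_finish

/-- Connectedness passes to the skeleton of the monic reflection, where the double-cover criterion
then gives a single tree. -/
theorem coconesFromAP_iff [Finite I] [Finite (Σ X Y : I, X ⟶ Y)] {N : ℕ} (hN : 2 ≤ N)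
    (e : (Σ X Y : I, X ⟶ Y) ↪ Fin N) :
    CoconesFromAP.{w, w', u, v} I ↔ HasBoundedCocones N I ∧ CategoryTheory.IsConnected I := by
  constructor
  · intro h
    have h' : CoconesFromAPJEP.{w, w', u, v} I := fun C _ hC _ F => h C hC F
    exact ⟨((UpwardSimplyConnected.tfae.{w, w', u, v} hN e).out 1 3).2 h', h.isConnected⟩
  · rintro ⟨h, hI⟩
    have ht := h.isThin e
    have := finite_monicSkeleton (I := I)
    have := isConnected_monicSkeleton (I := I)
    exact .of_treeLike (.of_hasDoubleCoverCocones _ (h.hasDoubleCoverCocones_monicSkeleton hN))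

end Equivalences

/-! ### Bounded quantifiers and digits -/

section PrimrecTools

variable {α : Type*} [Primcodable α]

theorem PrimrecPred.imp {p q : α → Prop} (hp : PrimrecPred p) (hq : PrimrecPred q) :
    PrimrecPred fun a => p a → q a :=
  (hp.not.or hq).of_eq fun _ => imp_iff_not_or.symm

theorem PrimrecPred.forall_lt_bound {b : α → ℕ} {p : α → ℕ → Prop} (hb : Primrec b)
    (hp : PrimrecPred fun q : α × ℕ => p q.1 q.2) : PrimrecPred fun a => ∀ x < b a, p a x := by
  have hR : PrimrecRel fun (x : ℕ) (a : α) => p a x :=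
    hp.comp (Primrec.pair Primrec.snd Primrec.fst)
  exact (hR.forall_mem_list.comp (Primrec.list_range.comp hb) Primrec.id).of_eq
    fun a => by simp

theorem PrimrecPred.exists_lt_bound {b : α → ℕ} {p : α → ℕ → Prop} (hb : Primrec b)
    (hp : PrimrecPred fun q : α × ℕ => p q.1 q.2) : PrimrecPred fun a => ∃ x < b a, p a x := by
  have hR : PrimrecRel fun (x : ℕ) (a : α) => p a x :=
    hp.comp (Primrec.pair Primrec.snd Primrec.fst)
  exact (hR.exists_mem_list.comp (Primrec.list_range.comp hb) Primrec.id).of_eq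
    fun a => by simp

theorem Primrec.nat_pow : Primrec₂ ((· ^ ·) : ℕ → ℕ → ℕ) :=
  Primrec₂.unpaired'.1 Nat.Primrec.pow

theorem Primrec.fst_comp {β γ : Type*} [Primcodable β] [Primcodable γ] {f : α → β × γ}
    (hf : Primrec f) : Primrec fun a => (f a).1 := Primrec.fst.comp hf

theorem Primrec.snd_comp {β γ : Type*} [Primcodable β] [Primcodable γ] {f : α → β × γ}
    (hf : Primrec f) : Primrec fun a => (f a).2 := Primrec.snd.comp hf

theorem Primrec.add_comp {f g : α → ℕ} (hf : Primrec f) (hg : Primrec g) :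
    Primrec fun a => f a + g a := Primrec.nat_add.comp hf hg

theorem Primrec.mul_comp {f g : α → ℕ} (hf : Primrec f) (hg : Primrec g) :
    Primrec fun a => f a * g a := Primrec.nat_mul.comp hf hg

theorem Primrec.pow_comp {f g : α → ℕ} (hf : Primrec f) (hg : Primrec g) :
    Primrec fun a => f a ^ g a := Primrec.nat_pow.comp hf hg

theorem PrimrecPred.nat_eq {f g : α → ℕ} (hf : Primrec f) (hg : Primrec g) :
    PrimrecPred fun a => f a = g a := Primrec.eq.comp hf hg

end PrimrecTools

/-- The digit with number `i` of `x` in base `b`. -/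
def baseDigit (b x i : ℕ) : ℕ := x / b ^ i % b

theorem Primrec.baseDigit {α : Type*} [Primcodable α] {b x i : α → ℕ} (hb : Primrec b)
    (hx : Primrec x) (hi : Primrec i) : Primrec fun a => baseDigit (b a) (x a) (i a) :=
  Primrec.nat_mod.comp (Primrec.nat_div.comp hx (Primrec.nat_pow.comp hb hi)) hb

theorem exists_baseDigit_eq {b n : ℕ} (f : Fin n → Fin b) :
    ∃ x < b ^ n, ∀ i : Fin n, baseDigit b x i = f i := by
  refine ⟨finFunctionFinEquiv f, Fin.is_lt _, fun i => ?_⟩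
  have := congrFun (finFunctionFinEquiv.symm_apply_apply f) i
  exact (congrArg Fin.val this :)

/-- The function of two variables that is encoded by the digits of `x` in base `b`, the second
variable being less than `N`. -/
def digitTable (b N x i j : ℕ) : ℕ := baseDigit b x (j + N * i)

theorem Primrec.digitTable {α : Type*} [Primcodable α] {b N x i j : α → ℕ} (hb : Primrec b)
    (hN : Primrec N) (hx : Primrec x) (hi : Primrec i) (hj : Primrec j) :
    Primrec fun a => digitTable (b a) (N a) (x a) (i a) (j a) :=
  Primrec.baseDigit hb hx (Primrec.add_comp hj (Primrec.mul_comp hN hi))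

theorem exists_digitTable_eq {b n N : ℕ} (f : Fin n → Fin N → Fin b) :
    ∃ x < b ^ (n * N), ∀ (i : Fin n) (j : Fin N), digitTable b N x i j = f i j := by
  obtain ⟨x, hx, h⟩ := exists_baseDigit_eq fun k : Fin (n * N) =>
    f (finProdFinEquiv.symm k).1 (finProdFinEquiv.symm k).2
  refine ⟨x, hx, fun i j => ?_⟩
  have := h (finProdFinEquiv (i, j))
  rw [Equiv.symm_apply_apply] at this
  exact this

/-! ### The decision procedure -/

namespace CatTable

/-- The number of the source of a morphism. -/
def src (c : CatTable) (m : ℕ) : ℕ := (c.2.1.getD m (0, 0)).1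

/-- The number of the target of a morphism. -/
def tgt (c : CatTable) (m : ℕ) : ℕ := (c.2.1.getD m (0, 0)).2

/-- The number of the composite of two morphisms. -/
def cmp (c : CatTable) (m m' : ℕ) : ℕ := (c.2.2[m]?.bind fun row => row[m']?).getD 0

/-- A bound for the size of the sets in the diagrams to be considered. -/
def bound (c : CatTable) : ℕ := c.2.1.length + 2

/-- The table `G` is a diagram of injections between the sets given by the table `S`. -/
def IsDiagram (c : CatTable) (s g : ℕ) : Prop :=
  (∀ m < c.2.1.length, ∀ a < c.bound, digitTable 2 c.bound s (c.src m) a = 1 →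
    digitTable 2 c.bound s (c.tgt m) (digitTable c.bound c.bound g m a) = 1) ∧
  (∀ m < c.2.1.length, ∀ m' < c.2.1.length, c.tgt m = c.src m' → ∀ a < c.bound,
    digitTable 2 c.bound s (c.src m) a = 1 →
    digitTable c.bound c.bound g (c.cmp m m') a =
      digitTable c.bound c.bound g m' (digitTable c.bound c.bound g m a)) ∧
  (∀ m < c.2.1.length, ∀ a < c.bound, ∀ b < c.bound, digitTable 2 c.bound s (c.src m) a = 1 →
    digitTable 2 c.bound s (c.src m) b = 1 →
    digitTable c.bound c.bound g m a = digitTable c.bound c.bound g m b → a = b)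

/-- The table `f` is a cocone of injections over the diagram given by `s` and `g`. -/
def IsCocone (c : CatTable) (s g f : ℕ) : Prop :=
  (∀ m < c.2.1.length, ∀ a < c.bound, digitTable 2 c.bound s (c.src m) a = 1 →
    digitTable (c.1 * c.bound) c.bound f (c.tgt m) (digitTable c.bound c.bound g m a) =
      digitTable (c.1 * c.bound) c.bound f (c.src m) a) ∧
  (∀ x < c.1, ∀ a < c.bound, ∀ b < c.bound, digitTable 2 c.bound s x a = 1 →
    digitTable 2 c.bound s x b = 1 →
    digitTable (c.1 * c.bound) c.bound f x a = digitTable (c.1 * c.bound) c.bound f x b → a = b)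

/-- Every bounded diagram of injections, given by tables, has a cocone of injections. -/
def AllCocones (c : CatTable) : Prop :=
  ∀ s < 2 ^ (c.1 * c.bound), ∀ g < c.bound ^ (c.2.1.length * c.bound), c.IsDiagram s g →
    ∃ f < (c.1 * c.bound) ^ (c.1 * c.bound), c.IsCocone s g f

/-- Every set of objects that is closed under morphisms in both directions is trivial, and there
is an object. -/
def Connected (c : CatTable) : Prop :=
  0 < c.1 ∧ ∀ s < 2 ^ c.1, (∀ m < c.2.1.length, baseDigit 2 s (c.src m) = baseDigit 2 s (c.tgt m)) →
    ∀ x < c.1, ∀ y < c.1, baseDigit 2 s x = baseDigit 2 s y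

/-! ### Primitive recursiveness of the table conditions -/

section Primrec

variable {α : Type*} [Primcodable α]

theorem primrec_numObj {c : α → CatTable} (hc : Primrec c) : Primrec fun a => (c a).1 :=
  Primrec.fst.comp hc

theorem primrec_numArr {c : α → CatTable} (hc : Primrec c) :
    Primrec fun a => (c a).2.1.length :=
  Primrec.list_length.comp (Primrec.fst.comp (Primrec.snd.comp hc))

theorem primrec_bound {c : α → CatTable} (hc : Primrec c) : Primrec fun a => (c a).bound :=
  Primrec.nat_add.comp (primrec_numArr hc) (Primrec.const 2)

theorem primrec_src {c : α → CatTable} {m : α → ℕ} (hc : Primrec c) (hm : Primrec m) :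
    Primrec fun a => (c a).src (m a) :=
  Primrec.fst.comp ((Primrec.list_getD _).comp (Primrec.fst.comp (Primrec.snd.comp hc)) hm)

theorem primrec_tgt {c : α → CatTable} {m : α → ℕ} (hc : Primrec c) (hm : Primrec m) :
    Primrec fun a => (c a).tgt (m a) :=
  Primrec.snd.comp ((Primrec.list_getD _).comp (Primrec.fst.comp (Primrec.snd.comp hc)) hm)

theorem primrec_cmp {c : α → CatTable} {m m' : α → ℕ} (hc : Primrec c) (hm : Primrec m)
    (hm' : Primrec m') : Primrec fun a => (c a).cmp (m a) (m' a) :=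
  Primrec.option_getD.comp
    (Primrec.option_bind
      (Primrec.list_getElem?.comp (Primrec.snd.comp (Primrec.snd.comp hc)) hm)
      (Primrec.list_getElem?.comp Primrec.snd (hm'.comp Primrec.fst)).to₂)
    (Primrec.const 0)

theorem primrecPred_isDiagram {c : α → CatTable} {s g : α → ℕ} (hc : Primrec c) (hs : Primrec s)
    (hg : Primrec g) : PrimrecPred fun a => (c a).IsDiagram (s a) (g a) := by
  unfold IsDiagram
  refine .and ?_ (.and ?_ ?_)
  all_goals
    repeat' first
      | with_reducible apply PrimrecPred.forall_lt_bound
      | with_reducible apply PrimrecPred.imp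
      | with_reducible apply PrimrecPred.nat_eq
      | with_reducible apply Primrec.digitTable
      | with_reducible apply primrec_src
      | with_reducible apply primrec_tgt
      | with_reducible apply primrec_cmp
      | with_reducible apply primrec_bound
      | with_reducible apply primrec_numArr
      | with_reducible apply primrec_numObj
      | with_reducible exact Primrec.snd
      | with_reducible exact Primrec.fst
      | with_reducible exact hc
      | with_reducible exact hs
      | with_reducible exact hg
      | with_reducible exact Primrec.const _
      | with_reducible apply Primrec.snd_comp
      | with_reducible apply Primrec.fst_comp
      | with_reducible exact hc.comp (by repeat' first | exact Primrec.fst | apply Primrec.fst_comp)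
      | with_reducible exact hs.comp (by repeat' first | exact Primrec.fst | apply Primrec.fst_comp)
      | with_reducible exact hg.comp (by repeat' first | exact Primrec.fst | apply Primrec.fst_comp)

theorem primrecPred_isCocone {c : α → CatTable} {s g f : α → ℕ} (hc : Primrec c) (hs : Primrec s)
    (hg : Primrec g) (hf : Primrec f) :
    PrimrecPred fun a => (c a).IsCocone (s a) (g a) (f a) := by
  unfold IsCocone
  refine .and ?_ ?_
  all_goals
    repeat' first
      | with_reducible apply PrimrecPred.forall_lt_bound
      | with_reducible apply PrimrecPred.imp
      | with_reducible apply PrimrecPred.nat_eq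
      | with_reducible apply Primrec.digitTable
      | with_reducible apply primrec_src
      | with_reducible apply primrec_tgt
      | with_reducible apply primrec_cmp
      | with_reducible apply primrec_bound
      | with_reducible apply primrec_numArr
      | with_reducible apply primrec_numObj
      | with_reducible exact Primrec.snd
      | with_reducible exact Primrec.fst
      | with_reducible exact hc
      | with_reducible exact hs
      | with_reducible exact hg
      | with_reducible exact hf
      | with_reducible apply Primrec.mul_comp
      | with_reducible exact Primrec.const _
      | with_reducible apply Primrec.snd_comp
      | with_reducible apply Primrec.fst_comp
      | with_reducible exact hc.comp (by repeat' first | exact Primrec.fst | apply Primrec.fst_comp)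
      | with_reducible exact hs.comp (by repeat' first | exact Primrec.fst | apply Primrec.fst_comp)
      | with_reducible exact hg.comp (by repeat' first | exact Primrec.fst | apply Primrec.fst_comp)
      | with_reducible exact hf.comp (by repeat' first | exact Primrec.fst | apply Primrec.fst_comp)

end Primrec

theorem primrecPred_allCocones : PrimrecPred AllCocones := by
  have hS : Primrec fun c : CatTable => c.1 * c.bound :=
    Primrec.mul_comp (primrec_numObj Primrec.id) (primrec_bound Primrec.id)
  have hc : Primrec fun q : (CatTable × ℕ) × ℕ => q.1.1 := Primrec.fst.comp Primrec.fst
  have hs : Primrec fun q : (CatTable × ℕ) × ℕ => q.1.2 := Primrec.snd.comp Primrec.fst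
  refine .forall_lt_bound (Primrec.pow_comp (Primrec.const 2) hS) (.forall_lt_bound
    (Primrec.pow_comp (primrec_bound Primrec.fst) (Primrec.mul_comp (primrec_numArr Primrec.fst)
      (primrec_bound Primrec.fst))) (.imp (primrecPred_isDiagram hc hs Primrec.snd)
    (.exists_lt_bound (Primrec.pow_comp (hS.comp hc) (hS.comp hc))
      (primrecPred_isCocone (hc.comp Primrec.fst) (hs.comp Primrec.fst)
        (Primrec.snd.comp Primrec.fst) Primrec.snd))))

theorem primrecPred_connected : PrimrecPred Connected := by
  have hc : Primrec fun q : CatTable × ℕ => q.1 := Primrec.fst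
  have hc' : Primrec fun q : (CatTable × ℕ) × ℕ => q.1.1 := Primrec.fst.comp Primrec.fst
  have hs : Primrec fun q : (CatTable × ℕ) × ℕ => q.1.2 := Primrec.snd.comp Primrec.fst
  refine .and (Primrec.nat_lt.comp (Primrec.const 0) (primrec_numObj Primrec.id))
    (.forall_lt_bound (Primrec.pow_comp (Primrec.const 2) (primrec_numObj Primrec.id))
      (.imp (.forall_lt_bound (primrec_numArr hc) (.nat_eq
        (.baseDigit (.const 2) hs (primrec_src hc' .snd))
        (.baseDigit (.const 2) hs (primrec_tgt hc' .snd))))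
        (.forall_lt_bound (primrec_numObj hc) (.forall_lt_bound (primrec_numObj hc') (.nat_eq
          (.baseDigit (.const 2) (hs.comp Primrec.fst) (Primrec.snd.comp Primrec.fst))
          (.baseDigit (.const 2) (hs.comp Primrec.fst) Primrec.snd))))))

/-! ### Correctness of the decision procedure -/

namespace Presentation

variable {I : Type w} [Category.{w'} I] {c : CatTable}

/-- The number of a morphism. -/
def num (P : c.Presentation I) {X Y : I} (f : X ⟶ Y) : Fin c.2.1.length := P.arr ⟨X, Y, f⟩

theorem src_num (P : c.Presentation I) {X Y : I} (f : X ⟶ Y) : c.src (P.num f) = P.obj X := by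
  have := congrArg Prod.fst (P.endpoints f)
  simpa [src, num, List.getD_eq_getElem] using this

theorem tgt_num (P : c.Presentation I) {X Y : I} (f : X ⟶ Y) : c.tgt (P.num f) = P.obj Y := by
  have := congrArg Prod.snd (P.endpoints f)
  simpa [tgt, num, List.getD_eq_getElem] using this

theorem cmp_num (P : c.Presentation I) {X Y Z : I} (f : X ⟶ Y)
    (g : Y ⟶ Z) : c.cmp (P.num f) (P.num g) = P.num (f ≫ g) := by
  have := P.comp f g
  unfold cmp num
  rw [this]
  rfl

theorem exists_num (P : c.Presentation I) {m : ℕ} (hm : m < c.2.1.length) :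
    ∃ (X Y : I) (f : X ⟶ Y), m = P.num f :=
  ⟨_, _, (P.arr.symm ⟨m, hm⟩).2.2, by simp [num]⟩

theorem exists_obj (P : c.Presentation I) {x : ℕ} (hx : x < c.1) : ∃ X : I, x = P.obj X :=
  ⟨P.obj.symm ⟨x, hx⟩, by simp⟩

theorem finite_obj (P : c.Presentation I) : Finite I := Finite.of_equiv _ P.obj.symm

theorem finite_arr (P : c.Presentation I) : Finite (Σ X Y : I, X ⟶ Y) := Finite.of_equiv _ P.arr.symm

/-- The morphisms embed into a finite set of the size that is used in the decision procedure. -/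
def arrEmbedding (P : c.Presentation I) : (Σ X Y : I, X ⟶ Y) ↪ Fin c.bound :=
  P.arr.toEmbedding.trans (Fin.castLEEmb (Nat.le_add_right _ 2))

theorem connected_iff (P : c.Presentation I) : c.Connected ↔ CategoryTheory.IsConnected I := by
  classical
  constructor
  · rintro ⟨h0, h⟩
    have : Nonempty I := ⟨P.obj.symm ⟨0, h0⟩⟩
    obtain ⟨X⟩ := this
    refine IsConnected.of_induct (j₀ := X) fun p hX hp Y => ?_
    obtain ⟨s, hs, hd⟩ := exists_baseDigit_eq fun k => if P.obj.symm k ∈ p then (1 : Fin 2) else 0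
    have hd' : ∀ Z, baseDigit 2 s (P.obj Z) = if Z ∈ p then 1 else 0 := fun Z => by
      rw [hd, P.obj.symm_apply_apply]
      split <;> rfl
    have key := h s hs (fun m hm => by
      obtain ⟨A, B, f, rfl⟩ := P.exists_num hm
      rw [P.src_num, P.tgt_num, hd', hd']
      simp only [hp f]) _ (P.obj X).2 _ (P.obj Y).2
    rw [hd', hd', if_pos hX] at key
    by_contra hY
    simp [hY] at key
  · intro hI
    refine ⟨(Fin.pos_iff_nonempty).2 (hI.is_nonempty.map P.obj), fun s _ h x hx y hy => ?_⟩
    obtain ⟨X, rfl⟩ := P.exists_obj hx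
    obtain ⟨Y, rfl⟩ := P.exists_obj hy
    refine constant_of_preserves_morphisms (fun X => baseDigit 2 s (P.obj X))
      (fun A B f => ?_) X Y
    have := h _ (P.num f).2
    rwa [P.src_num, P.tgt_num] at this

theorem hasBoundedCocones_of_allCocones (P : c.Presentation I) (h : c.AllCocones) :
    HasBoundedCocones c.bound I := by
  classical
  intro F hF
  have e : ∀ X, F.obj X ↪ Fin c.bound := fun X => (hF X).some
  obtain ⟨s, hs, hsd⟩ := exists_digitTable_eq fun (k : Fin c.1) (a : Fin c.bound) =>
    if ∃ x, e (P.obj.symm k) x = a then (1 : Fin 2) else 0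
  have hS : ∀ (X : I) (a : Fin c.bound),
      digitTable 2 c.bound s (P.obj X) a = 1 ↔ ∃ x, e X x = a := fun X a => by
    rw [hsd, P.obj.symm_apply_apply]
    split <;> simp_all
  have hS' : ∀ (X : I) {a : ℕ}, a < c.bound → digitTable 2 c.bound s (P.obj X) a = 1 →
      ∃ x, a = e X x := fun X a ha hx => by
    obtain ⟨x, hx⟩ := (hS X ⟨a, ha⟩).1 hx
    exact ⟨x, (congrArg Fin.val hx).symm⟩
  -- Off the image of the source set the value `a` is arbitrary; the conditions on the table never
  -- inspect it.
  obtain ⟨g, hg, hgd⟩ := exists_digitTable_eq fun (m : Fin c.2.1.length) (a : Fin c.bound) =>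
    if hx : ∃ x, e (P.arr.symm m).1 x = a then
      e (P.arr.symm m).2.1 (F.map (P.arr.symm m).2.2 hx.choose) else a
  have hG : ∀ {X Y : I} (f : X ⟶ Y) (x : F.obj X),
      digitTable c.bound c.bound g (P.num f) (e X x) = e Y (F.map f x) := fun {X Y} f x => by
    rw [hgd, num, P.arr.symm_apply_apply]
    have hx : ∃ x', e X x' = e X x := ⟨x, rfl⟩
    rw [dif_pos hx, (e X).injective hx.choose_spec]
  obtain ⟨t, -, ht, ht'⟩ := h s hs g hg (by
    refine ⟨?_, ?_, ?_⟩
    · intro m hm a ha hx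
      obtain ⟨X, Y, f, rfl⟩ := P.exists_num hm
      rw [P.src_num] at hx
      obtain ⟨x, rfl⟩ := hS' X ha hx
      rw [P.tgt_num, hG, hS]
      exact ⟨_, rfl⟩
    · intro m hm m' hm' hmm a ha hx
      obtain ⟨X, Y, f, rfl⟩ := P.exists_num hm
      obtain ⟨Y', Z, f', rfl⟩ := P.exists_num hm'
      rw [P.src_num, P.tgt_num] at hmm
      obtain rfl := P.obj.injective (Fin.ext hmm)
      rw [P.src_num] at hx
      obtain ⟨x, rfl⟩ := hS' X ha hx
      rw [P.cmp_num, hG, hG, hG, F.map_comp]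
    · intro m hm a ha b hb hx hy hab
      obtain ⟨X, Y, f, rfl⟩ := P.exists_num hm
      rw [P.src_num] at hx hy
      obtain ⟨x, rfl⟩ := hS' X ha hx
      obtain ⟨y, rfl⟩ := hS' X hb hy
      rw [hG, hG] at hab
      rw [F.injective f ((e Y).injective (Fin.ext hab))])
  refine ⟨fun X x => digitTable (c.1 * c.bound) c.bound t (P.obj X) (e X x), fun X x y hxy => ?_,
    fun {X Y} f x => ?_⟩
  · exact (e X).injective (Fin.ext (ht' _ (P.obj X).2 _ (e X x).2 _ (e X y).2
      ((hS X _).2 ⟨x, rfl⟩) ((hS X _).2 ⟨y, rfl⟩) hxy))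
  · have := ht _ (P.num f).2 _ (e X x).2 (by rw [P.src_num]; exact (hS X _).2 ⟨x, rfl⟩)
    rwa [P.src_num, P.tgt_num, hG] at this

theorem allCocones_of_hasBoundedCocones (P : c.Presentation I) (h : HasBoundedCocones c.bound I) :
    c.AllCocones := by
  classical
  rintro s - g - ⟨h1, h2, h3⟩
  have hlt : ∀ m a, digitTable c.bound c.bound g m a < c.bound :=
    fun m a => Nat.mod_lt _ (Nat.succ_pos _)
  obtain ⟨φ, hφ, hc⟩ := h
    { obj := fun X => {a : Fin c.bound // digitTable 2 c.bound s (P.obj X) a = 1}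
      map := fun {X Y} f a => ⟨⟨digitTable c.bound c.bound g (P.num f) a.1, hlt _ _⟩, by
        have := h1 _ (P.num f).2 _ a.1.2 (by rw [P.src_num]; exact a.2)
        rwa [P.tgt_num] at this⟩
      map_comp := fun {X Y Z} f f' a => by
        have := h2 _ (P.num f).2 _ (P.num f').2 (by rw [P.src_num, P.tgt_num]) _ a.1.2
          (by rw [P.src_num]; exact a.2)
        rw [P.cmp_num] at this
        exact Subtype.ext (Fin.ext this)
      injective := fun {X Y} f a b hab => Subtype.ext (Fin.ext (h3 _ (P.num f).2 _ a.1.2 _ b.1.2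
        (by rw [P.src_num]; exact a.2) (by rw [P.src_num]; exact b.2)
        (congrArg (fun z => (z.1 : ℕ)) hab))) }
    fun X => ⟨Function.Embedding.subtype _⟩
  -- replace the values of `φ` by chosen elements of the fibres
  let ψ : Fin c.1 × Fin c.bound → ℕ := fun p =>
    if hp : digitTable 2 c.bound s (P.obj (P.obj.symm p.1)) p.2 = 1 then
      φ (P.obj.symm p.1) ⟨p.2, hp⟩ else 0
  have hψ : ∀ (X : I) (a : Fin c.bound) (ha : digitTable 2 c.bound s (P.obj X) a = 1),
      ψ (P.obj X, a) = φ X ⟨a, ha⟩ := fun X a ha => by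
    obtain ⟨k, rfl⟩ := P.obj.symm.surjective X
    simp only [ψ, P.obj.apply_symm_apply] at ha ⊢
    exact dif_pos ha
  -- Each value of `ψ` is renamed to the number of a chosen pair in its fibre. There are `c.1 *
  -- c.bound` pairs, which is why digits in that base suffice to describe a cocone.
  let r := Function.surjInv (Set.rangeFactorization_surjective (f := ψ))
  obtain ⟨f, hf, hfd⟩ := exists_digitTable_eq fun (k : Fin c.1) (a : Fin c.bound) =>
    finProdFinEquiv (r (Set.rangeFactorization ψ (k, a)))
  have hr : ∀ p q : Fin c.1 × Fin c.bound,
      digitTable (c.1 * c.bound) c.bound f p.1 p.2 = digitTable (c.1 * c.bound) c.bound f q.1 q.2 ↔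
        ψ p = ψ q := fun p q => by
    rw [hfd, hfd, Fin.val_inj, finProdFinEquiv.injective.eq_iff,
      (Function.injective_surjInv _).eq_iff]
    exact Subtype.ext_iff
  refine ⟨f, hf, ?_, ?_⟩
  · intro m hm a ha hx
    obtain ⟨X, Y, i, rfl⟩ := P.exists_num hm
    rw [P.src_num] at hx
    have hy := h1 _ (P.num i).2 _ ha (by rw [P.src_num]; exact hx)
    rw [P.tgt_num] at hy
    rw [P.src_num, P.tgt_num]
    refine (hr (P.obj Y, ⟨_, hlt _ _⟩) (P.obj X, ⟨a, ha⟩)).2 ?_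
    rw [hψ Y _ hy, hψ X _ hx]
    exact hc i ⟨⟨a, ha⟩, hx⟩
  · intro x hx a ha b hb hxa hxb hab
    obtain ⟨X, rfl⟩ := P.exists_obj hx
    have := (hr (P.obj X, ⟨a, ha⟩) (P.obj X, ⟨b, hb⟩)).1 hab
    rw [hψ X _ hxa, hψ X _ hxb] at this
    exact congrArg (fun z => (z.1 : ℕ)) (hφ X this)

theorem allCocones_iff (P : c.Presentation I) : c.AllCocones ↔ HasBoundedCocones c.bound I :=
  ⟨P.hasBoundedCocones_of_allCocones, P.allCocones_of_hasBoundedCocones⟩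

end Presentation

end CatTable

theorem corollary6p1 :
    ∃ d d' : CatTable → Bool, Computable d ∧ Computable d' ∧
      ∀ (I : Type w) [Category.{w'} I] (c : CatTable), Nonempty (c.Presentation I) →
        (d c = true ↔ UpwardSimplyConnected I) ∧
        (d c = true ↔ CoconesFromAPJEP.{w, w', u, v} I) ∧
        (d' c = true ↔ CoconesFromAP.{w, w', u, v} I) ∧
        (UpwardSimplyConnected I ↔
          ∃ _ : Quiver.IsThin (MonicReflection I), ForestLike (ThinSkeleton (MonicReflection I))) := by
  classical
  refine ⟨fun c => decide c.AllCocones, fun c => decide (c.AllCocones ∧ c.Connected),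
    CatTable.primrecPred_allCocones.decide.to_comp,
    (CatTable.primrecPred_allCocones.and CatTable.primrecPred_connected).decide.to_comp, ?_⟩
  rintro I _ c ⟨P⟩
  have := P.finite_obj
  have := P.finite_arr
  -- The summand `2` in `bound` leaves room for the fibres of double covers even when `I` has fewer
  -- than two morphisms.
  have hN : 2 ≤ c.bound := Nat.le_add_left _ _
  have key := UpwardSimplyConnected.tfae.{w, w', u, v} hN P.arrEmbedding
  have hd : decide c.AllCocones = true ↔ UpwardSimplyConnected I := by
    rw [decide_eq_true_iff, P.allCocones_iff]
    exact key.out 1 0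
  refine ⟨hd, hd.trans (key.out 0 3), ?_, key.out 0 2⟩
  rw [decide_eq_true_iff, P.allCocones_iff, P.connected_iff]
  exact (coconesFromAP_iff hN P.arrEmbedding).symm
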